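/- Let $\mathcal D$ be a triangulated category with Grothendieck group $K(\mathcal D)$, let $\Gamma$ be a finitely generated free abelian group with a homomorphism $\mathrm{cl}\colon K(\mathcal D)\to\Gamma$, and let $0\subsetneq\Gamma_0\subsetneq\Gamma_1\subsetneq\cdots\subsetneq\Gamma_N=\Gamma$ be a filtration by subgroups such that each $\mathbb H_i=\Gamma_i/\Gamma_{i-1}$ ($0\le i\le N$, where $\Gamma_{-1}=0$) is free. Put $\mathbb H_i^\vee=\mathrm{Hom}_{\mathbb Z}(\mathbb H_i,\mathbb C)$ and fix a norm $\|\cdot\|_i$ on each $\mathbb H_i\otimes_{\mathbb Z}\mathbb R$. For $v\in\Gamma$ let $m$ be the least index with $v\in\Gamma_m$, let $[v]$ be the class of $v$ in $\mathbb H_m$, and put $\|v\|=\|[v]\|_m$ and $Z(v)=Z_m([v])$ for $Z=(Z_i)_i\in\prod_{i=0}^N\mathbb H_i^\vee$. A slicing $\mathcal P$ of $\mathcal D$ is a family of full subcategories $\mathcal P(\phi)$, $\phi\in\mathbb R$, closed under isomorphism and containing the zero objects, such that $\mathcal P(\phi)[1]=\mathcal P(\phi+1)$; $\mathrm{Hom}(E_1,E_2)=0$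 for $E_i\in\mathcal P(\phi_i)$ with $\phi_1>\phi_2$; and every $E\ne0$ has a finite chain $0=E_0\to E_1\to\cdots\to E_n=E$ with distinguished triangles $E_{j-1}\to E_j\to F_j\to E_{j-1}[1]$, where $0\ne F_j\in\mathcal P(\phi_j)$ and $\phi_1>\cdots>\phi_n$; put $\phi^+_{\mathcal P}(E)=\phi_1$ and $\phi^-_{\mathcal P}(E)=\phi_n$. For an interval $I$, $\mathcal P(I)$ is the smallest extension closed full subcategory containing all $\mathcal P(\phi)$, $\phi\in I$. If $A\xrightarrow{i}B\xrightarrow{j}C\to A[1]$ is a distinguished triangle with $A,B,C\in\mathcal P(I)$, then $i$ is called a strict monomorphism and $j$ a strict epimorphism of $\mathcal P(I)$. The slicing is locally finite if there is $0<\eta<1/2$ such that for every $\phi\in\mathbb R$, in $\mathcal P((\phi-\eta,\phi+\eta))$ every chain $\cdots\to X_1\to X_0$ of strict monomorphisms and every chain $X_0\to X_1\to\cdots$ of strict epimorphisms consists of isomorphisms from some point on. The set $\mathrm{Slice}(\mathcal D)$ of locally finite slicings carries the topology of the generalized metric $$d(\mathcal P,\mathcal Q)=\sup_{0\ne E\in\mathcal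 D}\max\{|\phi^-_{\mathcal P}(E)-\phi^-_{\mathcal Q}(E)|,\ |\phi^+_{\mathcal P}(E)-\phi^+_{\mathcal Q}(E)|\}\in[0,\infty].$$ Let $\mathrm{Stab}_{\Gamma_\bullet}(\mathcal D)$ be the set of pairs $(Z,\mathcal P)$ with $Z\in\prod_{i=0}^N\mathbb H_i^\vee$ and $\mathcal P\in\mathrm{Slice}(\mathcal D)$ such that $Z(\mathrm{cl}(E))\in\mathbb R_{>0}\exp(i\pi\phi)$ for all $\phi$ and all $0\ne E\in\mathcal P(\phi)$, and such that there is a constant $C>0$ with $\|\mathrm{cl}(E)\|\le C\,|Z(\mathrm{cl}(E))|$ for all $\phi$ and all $0\ne E\in\mathcal P(\phi)$. Give it the topology induced from $\mathrm{Slice}(\mathcal D)\times\prod_{i=0}^N\mathbb H_i^\vee$, where the second factor has its usual Euclidean topology. **Theorem.** The map $\Pi\colon\mathrm{Stab}_{\Gamma_\bullet}(\mathcal D)\to\prod_{i=0}^N\mathbb H_i^\vee$, $(Z,\mathcal P)\mapsto Z$, is a local homeomorphism. In particular, each connected component of $\mathrm{Stab}_{\Gamma_\bullet}(\mathcal D)$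 is a complex manifold: it is Hausdorff and second countable, and it has a holomorphic atlas modelled on $\prod_{i=0}^N\mathbb H_i^\vee$ for which the restriction of $\Pi$ is a local biholomorphism. -/

import Mathlib

open CategoryTheory CategoryTheory.Limits CategoryTheory.Pretriangulated
open scoped TensorProduct Manifold ContDiff ENNReal

noncomputable section

namespace WeakStab

universe v u w

/-! ### Slicings on a triangulated category -/

section Slicings

variable {D : Type u} [Category.{v} D] [Preadditive D] [HasZeroObject D] [HasShift D ℤ]
  [∀ n : ℤ, (shiftFunctor D n).Additive] [Pretriangulated D]

/-- A Harder-Narasimhan filtration of an object `E` with respect to a family of full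
subcategories `P φ`: a chain `0 = E₀ ⟶ E₁ ⟶ ⋯ ⟶ Eₙ ≅ E` together with distinguished triangles
`Eⱼ ⟶ Eⱼ₊₁ ⟶ Fⱼ ⟶ Eⱼ[1]` such that the `Fⱼ ∈ P (φⱼ)` are nonzero and `φ₀ > φ₁ > ⋯ > φₙ₋₁`.
(The values of `obj`, `factor`, … beyond the length `n` carry no meaning.) -/
structure HNFiltration (P : ℝ → ObjectProperty D) (E : D) where
  /-- the number of factors -/
  n : ℕ
  /-- the objects `Eⱼ`, for `j ≤ n` -/
  obj : ℕ → D
  /-- the factors `Fⱼ`, for `j < n` -/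
  factor : ℕ → D
  /-- the phases `φⱼ`, for `j < n` -/
  phase : ℕ → ℝ
  /-- the maps `Eⱼ ⟶ Eⱼ₊₁` -/
  ι : ∀ j, obj j ⟶ obj (j + 1)
  /-- the maps `Eⱼ₊₁ ⟶ Fⱼ` -/
  π : ∀ j, obj (j + 1) ⟶ factor j
  /-- the connecting maps `Fⱼ ⟶ Eⱼ[1]` -/
  δ : ∀ j, factor j ⟶ (obj j)⟦(1 : ℤ)⟧
  isZero_obj_zero : IsZero (obj 0)
  /-- the last object of the chain is `E` -/
  iso : obj n ≅ E
  distinguished : ∀ j < n, Triangle.mk (ι j) (π j) (δ j) ∈ distTriang D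
  mem_factor : ∀ j < n, P (phase j) (factor j)
  factor_ne_zero : ∀ j < n, ¬ IsZero (factor j)
  phase_lt : ∀ i j, i < j → j < n → phase j < phase i

variable (D) in
/-- A slicing: a family of (strictly) full subcategories `P φ`, `φ ∈ ℝ`, containing the zero
objects, compatible with the shift, without nonzero morphisms from higher to lower phase, and such
that every nonzero object has a Harder-Narasimhan filtration. (Closure of `P φ` under finite direct
sums follows from these axioms.) -/
@[ext]
structure Slicing where
  /-- the full subcategory of semistable objects of phase `φ` -/
  P : ℝ → ObjectProperty D
  closedUnderIso : ∀ φ, (P φ).IsClosedUnderIsomorphisms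
  zero_mem : ∀ φ (E : D), IsZero E → P φ E
  shift_iff : ∀ φ (E : D), P (φ + 1) (E⟦(1 : ℤ)⟧) ↔ P φ E
  hom_eq_zero : ∀ φ₁ φ₂ (E₁ E₂ : D), P φ₁ E₁ → P φ₂ E₂ → φ₂ < φ₁ → ∀ f : E₁ ⟶ E₂, f = 0
  exists_hn : ∀ E : D, ¬ IsZero E → Nonempty (HNFiltration P E)

/-- The smallest extension closed full subcategory containing `S`. -/
inductive ExtClosure (S : ObjectProperty D) : ObjectProperty D
  | of (X : D) (hX : S X) : ExtClosure S X
  | ext (T : Triangle D) (hT : T ∈ distTriang D) (h₁ : ExtClosure S T.obj₁)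
      (h₃ : ExtClosure S T.obj₃) : ExtClosure S T.obj₂

/-- `i : A ⟶ B` is a strict monomorphism of the full subcategory `Q`: there is a distinguished
triangle `A ⟶ B ⟶ C ⟶ A[1]` with first map `i` and `A`, `B`, `C` in `Q`. -/
def IsStrictMono (Q : ObjectProperty D) {A B : D} (i : A ⟶ B) : Prop :=
  Q A ∧ Q B ∧ ∃ (C : D) (j : B ⟶ C) (k : C ⟶ A⟦(1 : ℤ)⟧),
    Q C ∧ Triangle.mk i j k ∈ distTriang D

/-- `j : B ⟶ C` is a strict epimorphism of the full subcategory `Q`: there is a distinguished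
triangle `A ⟶ B ⟶ C ⟶ A[1]` with second map `j` and `A`, `B`, `C` in `Q`. -/
def IsStrictEpi (Q : ObjectProperty D) {B C : D} (j : B ⟶ C) : Prop :=
  Q B ∧ Q C ∧ ∃ (A : D) (i : A ⟶ B) (k : C ⟶ A⟦(1 : ℤ)⟧),
    Q A ∧ Triangle.mk i j k ∈ distTriang D

/-- `Q` is of finite length: every chain `⋯ ⟶ X₂ ⟶ X₁ ⟶ X₀` of strict monomorphisms and every
chain `X₀ ⟶ X₁ ⟶ X₂ ⟶ ⋯` of strict epimorphisms stabilizes. -/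
structure IsFiniteLength (Q : ObjectProperty D) : Prop where
  artinian : ∀ (X : ℕ → D) (f : ∀ n, X (n + 1) ⟶ X n), (∀ n, IsStrictMono Q (f n)) →
    ∃ m, ∀ n, m ≤ n → IsIso (f n)
  noetherian : ∀ (X : ℕ → D) (f : ∀ n, X n ⟶ X (n + 1)), (∀ n, IsStrictEpi Q (f n)) →
    ∃ m, ∀ n, m ≤ n → IsIso (f n)

namespace Slicing

/-- `P(I)` for a set of phases `I`: the extension closure of the `P φ`, `φ ∈ I`. -/
def interval (P : Slicing D) (I : Set ℝ) : ObjectProperty D :=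
  ExtClosure (fun E => ∃ φ ∈ I, P.P φ E)

/-- Local finiteness. The bound `η < 1/2` is the range in which `P((φ - η, φ + η))` is
quasi-abelian. -/
def IsLocallyFinite (P : Slicing D) : Prop :=
  ∃ η : ℝ, 0 < η ∧ η < 1 / 2 ∧
    ∀ φ : ℝ, IsFiniteLength (P.interval (Set.Ioo (φ - η) (φ + η)))

/-- A Harder-Narasimhan filtration of a nonzero object (unique up to isomorphism). -/
def hn (P : Slicing D) (E : D) (hE : ¬ IsZero E) : HNFiltration P.P E :=
  (P.exists_hn E hE).some

/-- `φ⁺(E)`, the largest phase of the Harder-Narasimhan factors of `E ≠ 0`. -/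
def phiPlus (P : Slicing D) (E : D) (hE : ¬ IsZero E) : ℝ := (P.hn E hE).phase 0

/-- `φ⁻(E)`, the smallest phase of the Harder-Narasimhan factors of `E ≠ 0`. -/
def phiMinus (P : Slicing D) (E : D) (hE : ¬ IsZero E) : ℝ :=
  (P.hn E hE).phase ((P.hn E hE).n - 1)

/-- The generalized metric on slicings. -/
def dist (P Q : Slicing D) : ℝ≥0∞ :=
  ⨆ (E : D) (hE : ¬ IsZero E),
    max (ENNReal.ofReal |P.phiMinus E hE - Q.phiMinus E hE|)
      (ENNReal.ofReal |P.phiPlus E hE - Q.phiPlus E hE|)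

lemma dist_self (P : Slicing D) : P.dist P = 0 := by
  simp [dist]

lemma dist_comm (P Q : Slicing D) : P.dist Q = Q.dist P := by
  simp only [dist, abs_sub_comm]

lemma dist_triangle (P Q R : Slicing D) : P.dist R ≤ P.dist Q + Q.dist R := by
  have key : ∀ a b c : ℝ, ENNReal.ofReal |a - c| ≤
      ENNReal.ofReal |a - b| + ENNReal.ofReal |b - c| := fun a b c => by
    rw [← ENNReal.ofReal_add (abs_nonneg _) (abs_nonneg _)]
    exact ENNReal.ofReal_le_ofReal (abs_sub_le a b c)
  refine iSup₂_le fun E hE => ?_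
  have h₁ := le_iSup₂ (f := fun (E : D) (hE : ¬ IsZero E) =>
    max (ENNReal.ofReal |P.phiMinus E hE - Q.phiMinus E hE|)
      (ENNReal.ofReal |P.phiPlus E hE - Q.phiPlus E hE|)) E hE
  have h₂ := le_iSup₂ (f := fun (E : D) (hE : ¬ IsZero E) =>
    max (ENNReal.ofReal |Q.phiMinus E hE - R.phiMinus E hE|)
      (ENNReal.ofReal |Q.phiPlus E hE - R.phiPlus E hE|)) E hE
  refine max_le ?_ ?_
  · exact (key _ _ _).trans (add_le_add ((le_max_left _ _).trans h₁) ((le_max_left _ _).trans h₂))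
  · exact (key _ _ _).trans (add_le_add ((le_max_right _ _).trans h₁) ((le_max_right _ _).trans h₂))

end Slicing

variable (D) in
/-- `Slice(D)`: the set of locally finite slicings. -/
def Slice := {P : Slicing D // P.IsLocallyFinite}

/-- `Slice(D)` with the topology of the generalized metric. -/
instance : PseudoEMetricSpace (Slice D) where
  edist P Q := P.1.dist Q.1
  edist_self P := P.1.dist_self
  edist_comm P Q := P.1.dist_comm Q.1
  edist_triangle P Q R := P.1.dist_triangle Q.1 R.1

variable (D) in
/-- The Grothendieck group `K(D)`: generators are the objects, relations `[B] = [A] + [C]` for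
distinguished triangles `A ⟶ B ⟶ C ⟶ A[1]`. -/
def K : Type u :=
  FreeAbelianGroup D ⧸ AddSubgroup.closure
    {x : FreeAbelianGroup D | ∃ T : Triangle D, T ∈ distTriang D ∧
      x = FreeAbelianGroup.of T.obj₂ - FreeAbelianGroup.of T.obj₁ - FreeAbelianGroup.of T.obj₃}

instance : AddCommGroup (K D) :=
  inferInstanceAs (AddCommGroup (FreeAbelianGroup D ⧸ AddSubgroup.closure
    {x : FreeAbelianGroup D | ∃ T : Triangle D, T ∈ distTriang D ∧
      x = FreeAbelianGroup.of T.obj₂ - FreeAbelianGroup.of T.obj₁ - FreeAbelianGroup.of T.obj₃}))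

/-- The class of an object in the Grothendieck group. -/
def K.cls (E : D) : K D := QuotientAddGroup.mk (FreeAbelianGroup.of E)

end Slicings

/-! ### Filtered lattices and central charges -/

section Lattice

/-- A filtration `0 ⊊ Γ₀ ⊊ Γ₁ ⊊ ⋯ ⊊ Γ_N = Γ` with free subquotients. With `Γ₋₁ = 0`, the group
`Γᵢ` is `sub i.succ` and `Γᵢ₋₁` is `sub i.castSucc`. -/
structure LatticeFiltration (Γ : Type w) [AddCommGroup Γ] (N : ℕ) where
  /-- the steps `0 = Γ₋₁, Γ₀, …, Γ_N` -/
  sub : Fin (N + 2) → Submodule ℤ Γ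
  strictMono : StrictMono sub
  sub_zero : sub 0 = ⊥
  sub_last : sub (Fin.last (N + 1)) = ⊤
  free : ∀ i : Fin (N + 1),
    Module.Free ℤ (↥(sub i.succ) ⧸ (sub i.castSucc).submoduleOf (sub i.succ))

namespace LatticeFiltration

variable {Γ : Type w} [AddCommGroup Γ] {N : ℕ} (F : LatticeFiltration Γ N)

/-- The subquotient `ℍᵢ = Γᵢ / Γᵢ₋₁`. -/
abbrev gr (i : Fin (N + 1)) : Type w :=
  ↥(F.sub i.succ) ⧸ (F.sub i.castSucc).submoduleOf (F.sub i.succ)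

instance (i : Fin (N + 1)) : Module.Free ℤ (F.gr i) := F.free i

lemma exists_mem (v : Γ) : ∃ i : Fin (N + 1), v ∈ F.sub i.succ :=
  ⟨Fin.last N, by rw [Fin.succ_last, F.sub_last]; trivial⟩

open Classical in
/-- The unique `m` with `v ∈ Γₘ ∖ Γₘ₋₁`, where for this purpose `Γ₋₁ = ∅`, so that `m = 0` for
`v = 0`; that is, the least `m` with `v ∈ Γₘ`. -/
def level (v : Γ) : Fin (N + 1) := Fin.find (fun i => v ∈ F.sub i.succ) (F.exists_mem v)

lemma mem_level (v : Γ) : v ∈ F.sub (F.level v).succ := by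
  classical
  exact Fin.find_spec (F.exists_mem v)

/-- The class `[v]` in `ℍₘ`, for `m` the level of `v`. -/
def symb (v : Γ) : F.gr (F.level v) := Submodule.Quotient.mk ⟨v, F.mem_level v⟩

end LatticeFiltration

/-- `ℍ^∨ = Hom(ℍ, ℂ)` for a free abelian group `ℍ` of finite rank, with the sup norm of the values
on a basis. It induces the usual topology of this finite dimensional complex vector space. -/
instance instNormedAddCommGroupDual (H : Type w) [AddCommGroup H] [Module.Free ℤ H]
    [Module.Finite ℤ H] : NormedAddCommGroup (H →ₗ[ℤ] ℂ) :=
  NormedAddCommGroup.induced (H →ₗ[ℤ] ℂ) (Module.Free.ChooseBasisIndex ℤ H → ℂ)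
    ((Module.Free.chooseBasis ℤ H).constr ℂ (M' := ℂ)).symm
    ((Module.Free.chooseBasis ℤ H).constr ℂ (M' := ℂ)).symm.injective

instance instNormedSpaceDual (H : Type w) [AddCommGroup H] [Module.Free ℤ H]
    [Module.Finite ℤ H] : NormedSpace ℂ (H →ₗ[ℤ] ℂ) :=
  NormedSpace.induced ℂ (H →ₗ[ℤ] ℂ) (Module.Free.ChooseBasisIndex ℤ H → ℂ)
    ((Module.Free.chooseBasis ℤ H).constr ℂ (M' := ℂ)).symm

variable {Γ : Type w} [AddCommGroup Γ] {N : ℕ}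

/-- A choice of a norm on each `ℍᵢ ⊗ ℝ`. -/
structure GrNorms (F : LatticeFiltration Γ N) where
  /-- the norm on `ℍᵢ ⊗ ℝ` -/
  nrm : ∀ i, Seminorm ℝ (ℝ ⊗[ℤ] F.gr i)
  eq_zero : ∀ i x, nrm i x = 0 → x = 0

/-- The function `v ↦ ‖[v]‖ₘ` on `Γ`, for `v ∈ Γₘ ∖ Γₘ₋₁`. -/
def GrNorms.eval {F : LatticeFiltration Γ N} (ν : GrNorms F) (v : Γ) : ℝ :=
  ν.nrm (F.level v) (1 ⊗ₜ[ℤ] F.symb v)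

/-- The space `∏ᵢ ℍᵢ^∨` of central charges. -/
abbrev Charges (F : LatticeFiltration Γ N) : Type w := ∀ i, F.gr i →ₗ[ℤ] ℂ

/-- The function `v ↦ Zₘ([v])` on `Γ`, for `v ∈ Γₘ ∖ Γₘ₋₁`. -/
def Charges.eval {F : LatticeFiltration Γ N} (Z : Charges F) (v : Γ) : ℂ :=
  Z (F.level v) (F.symb v)

end Lattice

/-! ### Weak stability conditions -/

section Stab

variable {D : Type u} [Category.{v} D] [Preadditive D] [HasZeroObject D] [HasShift D ℤ]
  [∀ n : ℤ, (shiftFunctor D n).Additive] [Pretriangulated D]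
  {Γ : Type w} [AddCommGroup Γ] [Module.Finite ℤ Γ] {N : ℕ}

/-- The axioms of a weak stability condition for a pair consisting of a slicing and a central
charge. -/
structure IsWeakStability (cl : K D →+ Γ) (F : LatticeFiltration Γ N) (ν : GrNorms F)
    (P : Slicing D) (Z : Charges F) : Prop where
  /-- `Z(E) ∈ ℝ_{>0} exp(iπφ)` for nonzero `E ∈ P φ`. -/
  phase : ∀ (φ : ℝ) (E : D), P.P φ E → ¬ IsZero E →
    ∃ r : ℝ, 0 < r ∧
      Z.eval (cl (K.cls E)) = (r : ℂ) * Complex.exp (Complex.I * (Real.pi : ℂ) * (φ : ℂ))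
  /-- the support property -/
  support : ∃ C : ℝ, 0 < C ∧ ∀ (φ : ℝ) (E : D), P.P φ E → ¬ IsZero E →
    ν.eval (cl (K.cls E)) ≤ C * ‖Z.eval (cl (K.cls E))‖

/-- The space of weak stability conditions, with the topology induced by the inclusion into
`Slice(D) × ∏ᵢ ℍᵢ^∨`. -/
abbrev Stab (cl : K D →+ Γ) (F : LatticeFiltration Γ N) (ν : GrNorms F) :=
  {σ : Slice D × Charges F // IsWeakStability cl F ν σ.1.1 σ.2}

/-- The forgetful map `(Z, P) ↦ Z`. -/
def Stab.charge (cl : K D →+ Γ) (F : LatticeFiltration Γ N) (ν : GrNorms F) :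
    Stab cl F ν → Charges F := fun σ => σ.1.2

end Stab

end WeakStab

end

set_option linter.unusedSectionVars false

/-! A slicing is governed by its t-structures: E lies in P((t, ∞)) or in P((-∞, t]) when it has no
maps to, or from, the semistable objects on the other side (`Slicing.gt`, `Slicing.le`).
Semistability, φ⁺, φ⁻ and the metric are all expressed by these classes, so no choice of
Harder-Narasimhan filtration matters.

The charge of a filtered lattice is not additive on triangles, because a class of higher level
absorbs one of lower level. What survives is `IsWeakCharge.tri`: if the charges of A and C lie in a
common open half plane, that of an extension B is one of the two or their sum. Sign conditions on
`height t`, the signed distance from the line at angle πt, therefore pass to extensions, and this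
replaces additivity throughout.

Local injectivity (`Slicing.HasCharge.unique`): if P and Q are at distance at most 1/4 and have the
same charge, an object caught between their truncations has height both positive and nonpositive, so
it vanishes.

Openness (`IsWeakStability.exists_deformation`): by the support property, W(E) - Z(E) is small
relative to Z(E) on semistable E, so phases move by less than ε (`IsDeformation`). The new slicing Q
is built through its t-structures. At each t only the window P((t - ε, t + ε]) has to be cut, and
finite length gives the cut according to the sign of the height (`IsDeformation.exists_trunc`).
Continuity of the height makes the classes right continuous in t, and finite length again yields
Harder-Narasimhan filtrations. The support property for Q follows by decomposing its semistable
objects with respect to P, since a bound of the norm by a multiple of a height is stable under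
extensions.

Thus Π is continuous, open and locally injective. Its local inverses are charts whose transition
maps are identities. Components are open, and second countable because a connected, paracompact,
locally separable space is separable. -/

namespace WeakStab

/-! ### Objects in distinguished triangles -/

section Triangles

variable {D : Type*} [Category D] [Preadditive D] [HasZeroObject D] [HasShift D ℤ]
  [∀ n : ℤ, (shiftFunctor D n).Additive] [Pretriangulated D]

/-- There is a distinguished triangle `A ⟶ B ⟶ C ⟶ A[1]`. -/
def Tri (A B C : D) : Prop :=
  ∃ (f : A ⟶ B) (g : B ⟶ C) (h : C ⟶ A⟦(1 : ℤ)⟧), Triangle.mk f g h ∈ distTriang D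

lemma Tri.of_dist {T : Triangle D} (hT : T ∈ distTriang D) : Tri T.obj₁ T.obj₂ T.obj₃ :=
  ⟨T.mor₁, T.mor₂, T.mor₃, hT⟩

lemma Tri.rotate {A B C : D} (h : Tri A B C) : Tri B C (A⟦(1 : ℤ)⟧) := by
  obtain ⟨f, g, k, h⟩ := h
  exact Tri.of_dist (rot_of_distTriang _ h)

lemma Tri.invRotate {A B C : D} (h : Tri A B C) : Tri (C⟦(-1 : ℤ)⟧) A B := by
  obtain ⟨f, g, k, h⟩ := h
  exact Tri.of_dist (inv_rot_of_distTriang _ h)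

lemma Tri.congr {A B C A' B' C' : D} (h : Tri A B C) (a : A ≅ A') (b : B ≅ B') (c : C ≅ C') :
    Tri A' B' C' := by
  obtain ⟨f, g, k, h⟩ := h
  refine ⟨a.inv ≫ f ≫ b.hom, b.inv ≫ g ≫ c.hom, c.inv ≫ k ≫ a.hom⟦1⟧', ?_⟩
  refine isomorphic_distinguished _ h _ (Triangle.isoMk _ _ a.symm b.symm c.symm ?_ ?_ ?_)
  · change (a.inv ≫ f ≫ b.hom) ≫ b.inv = a.inv ≫ f
    rw [Category.assoc, Category.assoc, b.hom_inv_id, Category.comp_id]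
  · change (b.inv ≫ g ≫ c.hom) ≫ c.inv = b.inv ≫ g
    rw [Category.assoc, Category.assoc, c.hom_inv_id, Category.comp_id]
  · change (c.inv ≫ k ≫ a.hom⟦1⟧') ≫ a.inv⟦1⟧' = c.inv ≫ k
    rw [Category.assoc, Category.assoc, ← Functor.map_comp, a.hom_inv_id,
      CategoryTheory.Functor.map_id,
      Category.comp_id]

lemma Tri.shift {A B C : D} (h : Tri A B C) (n : ℤ) : Tri (A⟦n⟧) (B⟦n⟧) (C⟦n⟧) := by
  obtain ⟨f, g, k, h⟩ := h
  exact Tri.of_dist (Triangle.shift_distinguished _ h n)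

open ZeroObject in
lemma tri_zero_left {Z : D} (hZ : IsZero Z) (X : D) : Tri Z X X :=
  (Tri.of_dist (contractible_distinguished₁ X)).congr ((isZero_zero D).iso hZ)
    (Iso.refl _) (Iso.refl _)

open ZeroObject in
lemma tri_zero_right {Z : D} (hZ : IsZero Z) (X : D) : Tri X X Z :=
  (Tri.of_dist (contractible_distinguished X)).congr (Iso.refl _) (Iso.refl _)
    ((isZero_zero D).iso hZ)

lemma Tri.nonempty_iso₁₂ {A B C : D} (h : Tri A B C) (hC : IsZero C) : Nonempty (A ≅ B) := by
  obtain ⟨f, g, k, h⟩ := h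
  have : IsIso f := (Triangle.isZero₃_iff_isIso₁ _ h).1 hC
  exact ⟨asIso f⟩

lemma Tri.nonempty_iso₂₃ {A B C : D} (h : Tri A B C) (hA : IsZero A) : Nonempty (B ≅ C) := by
  obtain ⟨f, g, k, h⟩ := h
  have : IsIso g := (Triangle.isZero₁_iff_isIso₂ _ h).1 hA
  exact ⟨asIso g⟩

/-- Morphisms out of an extension vanish if they vanish on both ends. -/
lemma Tri.hom_from_eq_zero {A B C X : D} (h : Tri A B C) (hA : ∀ f : A ⟶ X, f = 0)
    (hC : ∀ f : C ⟶ X, f = 0) (f : B ⟶ X) : f = 0 := by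
  obtain ⟨a, b, k, h⟩ := h
  obtain ⟨g, hg⟩ := Triangle.yoneda_exact₂ _ h f (hA _)
  exact hg.trans (by rw [hC g]; exact comp_zero)

/-- Morphisms into an extension vanish if they vanish on both ends. -/
lemma Tri.hom_to_eq_zero {A B C X : D} (h : Tri A B C) (hA : ∀ f : X ⟶ A, f = 0)
    (hC : ∀ f : X ⟶ C, f = 0) (f : X ⟶ B) : f = 0 := by
  obtain ⟨a, b, k, h⟩ := h
  obtain ⟨g, hg⟩ := Triangle.coyoneda_exact₂ _ h f (hC _)
  exact hg.trans (by rw [hA g]; exact zero_comp)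

lemma hom_from_eq_zero_of_iso {X Y Z : D} (e : X ≅ Y) (h : ∀ f : X ⟶ Z, f = 0) (f : Y ⟶ Z) :
    f = 0 := by
  rw [← e.inv_hom_id_assoc f, h (e.hom ≫ f), comp_zero]

lemma hom_to_eq_zero_of_iso {X Y Z : D} (e : X ≅ Y) (h : ∀ f : Z ⟶ X, f = 0) (f : Z ⟶ Y) :
    f = 0 := by
  rw [← Category.comp_id f, ← e.inv_hom_id, ← Category.assoc, h (f ≫ e.inv), zero_comp]

lemma isZero_of_hom_self {X : D} (h : ∀ f : X ⟶ X, f = 0) : IsZero X :=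
  (IsZero.iff_id_eq_zero X).2 (h _)

lemma isZero_shift {X : D} (n : ℤ) (h : IsZero X) : IsZero (X⟦n⟧) := (shiftFunctor D n).map_isZero h

lemma shift_hom_from {X Y : D} (n : ℤ) (h : ∀ f : X ⟶ Y⟦(-n)⟧, f = 0) (f : X⟦n⟧ ⟶ Y) : f = 0 := by
  apply (shiftFunctor D (-n)).map_injective
  have := hom_from_eq_zero_of_iso (shiftShiftNeg X n).symm h (f⟦(-n)⟧')
  simpa using this

lemma shift_hom_to {X Y : D} (n : ℤ) (h : ∀ f : X⟦(-n)⟧ ⟶ Y, f = 0) (f : X ⟶ Y⟦n⟧) : f = 0 := by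
  apply (shiftFunctor D (-n)).map_injective
  have := hom_to_eq_zero_of_iso (shiftShiftNeg Y n).symm h (f⟦(-n)⟧')
  simpa using this

variable [IsTriangulated D]

/-- Composition of the quotients `E ⟶ B ⟶ B'`. -/
lemma exists_comp_quot {A E B C B' : D} {f : A ⟶ E} {g : E ⟶ B} {h : B ⟶ A⟦(1 : ℤ)⟧}
    (hT : Triangle.mk f g h ∈ distTriang D) {f' : C ⟶ B} {g' : B ⟶ B'} {h' : B' ⟶ C⟦(1 : ℤ)⟧}
    (hT' : Triangle.mk f' g' h' ∈ distTriang D) :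
    ∃ (A' : D) (f'' : A' ⟶ E) (h'' : B' ⟶ A'⟦(1 : ℤ)⟧),
      Triangle.mk f'' (g ≫ g') h'' ∈ distTriang D ∧ Tri A A' C := by
  obtain ⟨A', f'', h'', h₂⟩ := distinguished_cocone_triangle₁ (g ≫ g')
  exact ⟨A', f'', h'', h₂, Tri.of_dist (Triangulated.someOctahedron' rfl hT hT' h₂).mem⟩

/-- Octahedral axiom: the kernel of a composite of quotients is an extension of the two kernels.
Together with its dual `Tri.comp_sub` it plays the role of the isomorphism theorems. -/
lemma Tri.comp_quot {A E B C B' : D} (h : Tri A E B) (h' : Tri C B B') :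
    ∃ A', Tri A' E B' ∧ Tri A A' C := by
  obtain ⟨f, g, k, h⟩ := h
  obtain ⟨f', g', k', h'⟩ := h'
  obtain ⟨A', f'', h'', h₁, h₂⟩ := exists_comp_quot h h'
  exact ⟨A', Tri.of_dist h₁, h₂⟩

lemma Tri.comp_sub {A E B A' C : D} (h : Tri A E B) (h' : Tri A' A C) :
    ∃ B', Tri A' E B' ∧ Tri C B' B := by
  obtain ⟨f, g, k, h⟩ := h
  obtain ⟨f', g', k', h'⟩ := h'
  obtain ⟨B', g'', k'', h₁⟩ := distinguished_cocone_triangle (f' ≫ f)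
  exact ⟨B', Tri.of_dist h₁, Tri.of_dist (Triangulated.someOctahedron rfl h' h h₁).mem⟩

end Triangles

/-! ### The t-structures of a slicing -/

namespace Slicing

section

variable {D : Type*} [Category D] [Preadditive D] [HasZeroObject D] [HasShift D ℤ]
  [∀ n : ℤ, (shiftFunctor D n).Additive] [Pretriangulated D]

/-- Objects without nonzero maps to semistable objects of phase `≤ t`; that is, `P((t, ∞))`. -/
def gt (P : Slicing D) (t : ℝ) (E : D) : Prop :=
  ∀ φ F, φ ≤ t → P.P φ F → ∀ f : E ⟶ F, f = 0

/-- Objects without nonzero maps from semistable objects of phase `> t`; that is, `P((-∞, t])`. -/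
def le (P : Slicing D) (t : ℝ) (E : D) : Prop :=
  ∀ φ F, t < φ → P.P φ F → ∀ f : F ⟶ E, f = 0

variable {P : Slicing D}

lemma P_iso {φ : ℝ} {X Y : D} (e : X ≅ Y) (h : P.P φ X) : P.P φ Y :=
  (P.closedUnderIso φ).of_iso e h

lemma P_shift_neg {φ : ℝ} {X : D} : P.P (φ - 1) (X⟦(-1 : ℤ)⟧) ↔ P.P φ X := by
  rw [← P.shift_iff, sub_add_cancel]
  exact ⟨P_iso (shiftNegShift X (1 : ℤ)), P_iso (shiftNegShift X (1 : ℤ)).symm⟩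

lemma gt_iso {t : ℝ} {X Y : D} (e : X ≅ Y) (h : P.gt t X) : P.gt t Y :=
  fun φ F hφ hF => hom_from_eq_zero_of_iso e (h φ F hφ hF)

lemma le_iso {t : ℝ} {X Y : D} (e : X ≅ Y) (h : P.le t X) : P.le t Y :=
  fun φ F hφ hF => hom_to_eq_zero_of_iso e (h φ F hφ hF)

lemma gt_zero {t : ℝ} {X : D} (h : IsZero X) : P.gt t X := fun _ _ _ _ f => h.eq_of_src f 0

lemma le_zero {t : ℝ} {X : D} (h : IsZero X) : P.le t X := fun _ _ _ _ f => h.eq_of_tgt f 0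

lemma gt_anti {s t : ℝ} (hst : s ≤ t) {X : D} (h : P.gt t X) : P.gt s X :=
  fun φ F hφ => h φ F (hφ.trans hst)

lemma le_mono {s t : ℝ} (hst : s ≤ t) {X : D} (h : P.le s X) : P.le t X :=
  fun φ F hφ => h φ F (hst.trans_lt hφ)

lemma gt_ext {t : ℝ} {A B C : D} (h : Tri A B C) (hA : P.gt t A) (hC : P.gt t C) : P.gt t B :=
  fun φ F hφ hF => h.hom_from_eq_zero (hA φ F hφ hF) (hC φ F hφ hF)

lemma le_ext {t : ℝ} {A B C : D} (h : Tri A B C) (hA : P.le t A) (hC : P.le t C) : P.le t B :=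
  fun φ F hφ hF => h.hom_to_eq_zero (hA φ F hφ hF) (hC φ F hφ hF)

lemma gt_of_P {s φ : ℝ} {X : D} (h : P.P φ X) (hs : s < φ) : P.gt s X :=
  fun ψ F hψ hF => P.hom_eq_zero φ ψ X F h hF (hψ.trans_lt hs)

lemma le_of_P {s φ : ℝ} {X : D} (h : P.P φ X) (hs : φ ≤ s) : P.le s X :=
  fun ψ F hψ hF => P.hom_eq_zero ψ φ F X hF h (hs.trans_lt hψ)

lemma isZero_of_P_gt {φ : ℝ} {X : D} (h : P.P φ X) (hs : P.gt φ X) : IsZero X :=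
  isZero_of_hom_self (hs φ X le_rfl h)

lemma isZero_of_P_le {s φ : ℝ} {X : D} (h : P.P φ X) (hs : P.le s X) (hlt : s < φ) : IsZero X :=
  isZero_of_hom_self (hs φ X hlt h)

lemma gt_shift {t : ℝ} {X : D} (h : P.gt t X) : P.gt (t + 1) (X⟦(1 : ℤ)⟧) :=
  fun φ F hφ hF => shift_hom_from 1 (h (φ - 1) _ (by linarith) (P_shift_neg.2 hF))

lemma le_shift {t : ℝ} {X : D} (h : P.le t X) : P.le (t + 1) (X⟦(1 : ℤ)⟧) :=
  fun φ F hφ hF => shift_hom_to 1 (h (φ - 1) _ (by linarith) (P_shift_neg.2 hF))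

lemma gt_shift_neg {t : ℝ} {X : D} (h : P.gt t X) : P.gt (t - 1) (X⟦(-1 : ℤ)⟧) :=
  fun φ F hφ hF => shift_hom_from (-1) (h (φ + 1) (F⟦(1 : ℤ)⟧) (by linarith) ((P.shift_iff _ _).2 hF))

lemma le_shift_neg {t : ℝ} {X : D} (h : P.le t X) : P.le (t - 1) (X⟦(-1 : ℤ)⟧) :=
  fun φ F hφ hF => shift_hom_to (-1) (h (φ + 1) (F⟦(1 : ℤ)⟧) (by linarith) ((P.shift_iff _ _).2 hF))

/-- A quotient of an object of `P((t, ∞))`. -/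
lemma gt_quot {s t : ℝ} {A B C : D} (h : Tri A B C) (hB : P.gt t B) (hA : P.gt s A)
    (hst : t ≤ s + 1) : P.gt t C :=
  gt_ext h.rotate hB (gt_anti hst (gt_shift hA))

/-- A subobject of an object of `P((-∞, t])`. -/
lemma le_sub {s t : ℝ} {A B C : D} (h : Tri A B C) (hB : P.le t B) (hC : P.le s C)
    (hst : s - 1 ≤ t) : P.le t A :=
  le_ext h.invRotate (le_mono hst (le_shift_neg hC)) hB

end

end Slicing

/-! ### Iterated extensions with decreasing phases -/

section HN

variable {D : Type*} [Category D] [Preadditive D] [HasZeroObject D] [HasShift D ℤ]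
  [∀ n : ℤ, (shiftFunctor D n).Additive] [Pretriangulated D]

/-- Objects with a Harder-Narasimhan filtration with phases in `(s, u]`. -/
inductive HNIoc (Q : ℝ → ObjectProperty D) (u : ℝ) : ℝ → D → Prop
  | zero (s : ℝ) (X : D) (hX : IsZero X) : HNIoc Q u s X
  | step (s φ : ℝ) (A E B : D) (hs : s < φ) (hu : φ ≤ u) (hA : HNIoc Q u φ A) (hB : Q φ B)
      (h : Tri A E B) : HNIoc Q u s E

variable {Q : ℝ → ObjectProperty D}

lemma HNIoc.of_iso {u s : ℝ} {X Y : D} (h : HNIoc Q u s X) (e : X ≅ Y) : HNIoc Q u s Y := by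
  cases h with
  | zero _ _ hX => exact .zero _ _ (hX.of_iso e.symm)
  | step _ φ A _ B hs hu hA hB h =>
    exact .step s φ A Y B hs hu hA hB (h.congr (Iso.refl _) e (Iso.refl _))

lemma HNIoc.mono {u u' s s' : ℝ} {X : D} (h : HNIoc Q u s X) (hs : s' ≤ s) (hu : u ≤ u') :
    HNIoc Q u' s' X := by
  induction h generalizing s' with
  | zero _ _ hX => exact .zero _ _ hX
  | step s φ A E B hs' hu' hA hB h ih =>
    exact .step s' φ A E B (hs.trans_lt hs') (hu'.trans hu) (ih le_rfl) hB h

lemma HNIoc.induction {u s : ℝ} {X : D} (h : HNIoc Q u s X) {p : D → Prop}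
    (h0 : ∀ X, IsZero X → p X) (h1 : ∀ φ X, s < φ → φ ≤ u → Q φ X → p X)
    (h2 : ∀ A B C, Tri A B C → p A → p C → p B) : p X := by
  induction h with
  | zero _ _ hX => exact h0 _ hX
  | step s φ A E B hs' hu' hA hB h ih =>
    exact h2 _ _ _ h (ih fun ψ X hψ => h1 ψ X (hs'.trans hψ)) (h1 φ B hs' hu' hB)

/-- Induction for nonzero objects. -/
lemma HNIoc.induction_ne {u s : ℝ} {X : D} (h : HNIoc Q u s X) (hX : ¬ IsZero X) {p : D → Prop}
    (hiso : ∀ X Y, (X ≅ Y) → p X → p Y)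
    (h1 : ∀ φ X, s < φ → φ ≤ u → Q φ X → ¬ IsZero X → p X)
    (h2 : ∀ A B C, Tri A B C → p A → p C → p B) : p X := by
  have := h.induction (p := fun X => IsZero X ∨ p X) (fun X h => .inl h)
    (fun φ X a b c => or_iff_not_imp_left.2 (h1 φ X a b c)) (fun A B C h hA hC => by
      rcases hA with hA | hA
      · obtain ⟨e⟩ := h.nonempty_iso₂₃ hA
        exact hC.imp (fun hC => hC.of_iso e) (hiso _ _ e.symm)
      · rcases hC with hC | hC
        · obtain ⟨e⟩ := h.nonempty_iso₁₂ hC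
          exact .inr (hiso _ _ e hA)
        · exact .inr (h2 _ _ _ h hA hC))
  exact this.resolve_left hX

variable [IsTriangulated D]

/-- The filtration of B is lifted along E ⟶ B one factor at a time: the last factor of B becomes the
last factor of E. -/
lemma HNIoc.concat {u s t : ℝ} {A E B : D} (hB : HNIoc Q t s B) (hA : HNIoc Q u t A) (hst : s ≤ t)
    (htu : t ≤ u) (h : Tri A E B) : HNIoc Q u s E := by
  induction hB generalizing A E with
  | zero s B hB =>
    obtain ⟨e⟩ := h.nonempty_iso₁₂ hB
    exact (hA.of_iso e).mono hst le_rfl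
  | step s φ B' B C hs hu hB' hC h' ih =>
    obtain ⟨A', h₁, h₂⟩ := h.comp_quot h'
    exact .step s φ A' E C hs (hu.trans htu) (ih hA hu h₂) hC h₁

/-- Truncation of an iterated extension. -/
lemma HNIoc.exists_tri {u s : ℝ} {X : D} (h : HNIoc Q u s X) (t : ℝ) :
    ∃ A B, Tri A X B ∧ HNIoc Q u t A ∧ HNIoc Q t s B := by
  induction h with
  | zero s X hX => exact ⟨X, X, tri_zero_left hX X, .zero _ _ hX, .zero _ _ hX⟩
  | step s φ A E C hs hu hA hC h ih =>
    -- Phases decrease along the filtration, so a last phase above t puts all of E above t.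
    rcases lt_or_ge t φ with htφ | htφ
    · obtain ⟨Z, hZ⟩ := (inferInstance : HasZeroObject D).zero
      exact ⟨E, Z, tri_zero_right hZ E, .step t φ A E C htφ hu hA hC h, .zero _ _ hZ⟩
    · obtain ⟨A', B', h', hA', hB'⟩ := ih
      obtain ⟨B'', h₁, h₂⟩ := h.comp_sub h'
      exact ⟨A', B'', h₁, hA', .step s φ B' B'' C hs htφ hB' hC h₂⟩

end HN

section

variable {D : Type*} [Category D] [Preadditive D] [HasZeroObject D] [HasShift D ℤ]
  [∀ n : ℤ, (shiftFunctor D n).Additive] [Pretriangulated D]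

/-! ### Comparison with Harder-Narasimhan filtrations -/

namespace HNFiltration

variable {Q : ℝ → ObjectProperty D} {E : D}

lemma tri (h : HNFiltration Q E) {j : ℕ} (hj : j < h.n) :
    Tri (h.obj j) (h.obj (j + 1)) (h.factor j) := Tri.of_dist (h.distinguished j hj)

lemma n_pos (h : HNFiltration Q E) (hE : ¬ IsZero E) : 0 < h.n := by
  rcases Nat.eq_zero_or_pos h.n with h0 | h0
  · refine absurd ?_ hE
    have := h.iso
    rw [h0] at this
    exact h.isZero_obj_zero.of_iso this.symm
  · exact h0

lemma phase_le_first (h : HNFiltration Q E) {j : ℕ} (hj : j < h.n) : h.phase j ≤ h.phase 0 := by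
  rcases Nat.eq_zero_or_pos j with rfl | h0
  · exact le_rfl
  · exact (h.phase_lt 0 j h0 hj).le

lemma last_le_phase (h : HNFiltration Q E) {j : ℕ} (hj : j < h.n) :
    h.phase (h.n - 1) ≤ h.phase j := by
  rcases Nat.lt_or_ge j (h.n - 1) with h0 | h0
  · exact (h.phase_lt j _ h0 (by omega)).le
  · rw [show j = h.n - 1 by omega]

lemma hnIoc_obj (h : HNFiltration Q E) {j : ℕ} (hj : j ≤ h.n) {s u : ℝ}
    (hs : ∀ i < j, s < h.phase i) (hu : ∀ i < j, h.phase i ≤ u) : HNIoc Q u s (h.obj j) := by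
  induction j generalizing s with
  | zero => exact .zero _ _ h.isZero_obj_zero
  | succ j ih =>
    exact .step s (h.phase j) (h.obj j) _ (h.factor j) (hs j (by omega)) (hu j (by omega))
      (ih (by omega) (fun i hi => h.phase_lt i j hi (by omega)) fun i hi => hu i (by omega))
      (h.mem_factor j (by omega)) (h.tri (by omega))

lemma hnIoc (h : HNFiltration Q E) {s u : ℝ} (hs : s < h.phase (h.n - 1)) (hu : h.phase 0 ≤ u) :
    HNIoc Q u s E :=
  (h.hnIoc_obj le_rfl (fun _ hi => hs.trans_le (h.last_le_phase hi))
    fun _ hi => (h.phase_le_first hi).trans hu).of_iso h.iso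

end HNFiltration

/-- The steps of `HNIoc` may have zero factors, which a filtration forbids; such a step is absorbed
into the final isomorphism. -/
lemma HNIoc.exists_hnFiltration {Q : ℝ → ObjectProperty D} {u s : ℝ} {E : D} (h : HNIoc Q u s E) :
    ∃ F : HNFiltration Q E, ∀ j < F.n, s < F.phase j := by
  induction h with
  | zero s X hX =>
    refine ⟨⟨0, fun _ => X, fun _ => X, fun _ => 0, fun _ => 0, fun _ => 0, fun _ => 0, hX,
      Iso.refl _, ?_, ?_, ?_, ?_⟩, ?_⟩
    all_goals simp
  | step s φ A E B hs hu hA hB h ih =>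
    obtain ⟨F, hF⟩ := ih
    by_cases hB0 : IsZero B
    · obtain ⟨e⟩ := h.nonempty_iso₁₂ hB0
      exact ⟨⟨F.n, F.obj, F.factor, F.phase, F.ι, F.π, F.δ, F.isZero_obj_zero, F.iso ≪≫ e,
        F.distinguished, F.mem_factor, F.factor_ne_zero, F.phase_lt⟩,
        fun j hj => hs.trans (hF j hj)⟩
    -- The old data followed by E and B. The objects are identified only after a case split on j, so
    -- the triangles are stated as `Tri` and their maps chosen afterwards.
    · have key : ∀ j < F.n + 1,
          Tri (if j ≤ F.n then F.obj j else E) (if j + 1 ≤ F.n then F.obj (j + 1) else E)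
            (if j < F.n then F.factor j else B) ∧
          Q (if j < F.n then F.phase j else φ) (if j < F.n then F.factor j else B) ∧
          ¬ IsZero (if j < F.n then F.factor j else B) := by
        intro j hj
        rcases Nat.lt_or_ge j F.n with h1 | h1
        · rw [if_pos h1.le, if_pos h1, if_pos h1, if_pos (Nat.succ_le_of_lt h1)]
          exact ⟨F.tri h1, F.mem_factor j h1, F.factor_ne_zero j h1⟩
        · obtain rfl : j = F.n := by omega
          rw [if_pos le_rfl, if_neg (lt_irrefl _), if_neg (lt_irrefl _), if_neg (by omega)]
          exact ⟨h.congr F.iso.symm (Iso.refl _) (Iso.refl _), hB, hB0⟩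
      have key' : ∀ j < F.n + 1, s < if j < F.n then F.phase j else φ := by
        intro j hj
        split_ifs with h1
        · exact hs.trans (hF j h1)
        · exact hs
      choose! f g k hfg using fun j hj => (key j hj).1
      refine ⟨⟨F.n + 1, fun j => if j ≤ F.n then F.obj j else E,
        fun j => if j < F.n then F.factor j else B, fun j => if j < F.n then F.phase j else φ,
        f, g, k, ?_, eqToIso (if_neg (by omega)), hfg, fun j hj => (key j hj).2.1,
        fun j hj => (key j hj).2.2, ?_⟩, key'⟩
      · rw [if_pos (Nat.zero_le _)]
        exact F.isZero_obj_zero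
      · intro i j hij hj
        rw [if_pos (by omega : i < F.n)]
        split_ifs with h1
        · exact F.phase_lt i j hij h1
        · exact hF i (by omega)

namespace Slicing

variable {P : Slicing D} {E : D}

lemma gt_of_hnIoc {u s : ℝ} (h : HNIoc P.P u s E) : P.gt s E :=
  h.induction (fun _ => gt_zero) (fun _ _ hφ _ hX => gt_of_P hX hφ) fun _ _ _ => gt_ext

lemma le_of_hnIoc {u s : ℝ} (h : HNIoc P.P u s E) : P.le u E :=
  h.induction (fun _ => le_zero) (fun _ _ _ hφ hX => le_of_P hX hφ) fun _ _ _ => le_ext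

/-- Since Eⱼ is an extension of Eⱼ₊₁ by Fⱼ[-1], an upper bound below the first phase would descend
the chain to E₁ ≅ F₀ and force F₀ = 0. -/
lemma first_le_of_le (F : HNFiltration P.P E) (hE : ¬ IsZero E) {t : ℝ} (h : P.le t E) :
    F.phase 0 ≤ t := by
  by_contra! ht
  -- The objects Fⱼ[-1] have phases at most φ₀ - 1, whence the maximum; all that matters is that it
  -- stays below φ₀.
  have key : ∀ j, j < F.n → P.le (max t (F.phase 0 - 1)) (F.obj (F.n - j)) := by
    intro j
    induction j with
    | zero => exact fun _ => le_mono (le_max_left _ _) (le_iso F.iso.symm h)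
    | succ j ih =>
      intro hj
      have h1 := F.tri (j := F.n - (j + 1)) (by omega)
      rw [show F.n - (j + 1) + 1 = F.n - j by omega] at h1
      refine le_sub h1 (ih (by omega)) (le_of_P (F.mem_factor _ (by omega))
        (F.phase_le_first (by omega))) (le_max_right _ _)
  have hn := F.n_pos hE
  have h1 := key (F.n - 1) (by omega)
  rw [show F.n - (F.n - 1) = 0 + 1 by omega] at h1
  obtain ⟨e⟩ := (F.tri hn).nonempty_iso₂₃ F.isZero_obj_zero
  exact F.factor_ne_zero 0 hn (isZero_of_P_le (F.mem_factor 0 hn) (le_iso e h1)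
    (max_lt ht (by linarith)))

/-- The last factor is an extension of Eₙ₋₁[1] by E; if its phase were at most t, it would have no
nonzero map to itself. -/
lemma lt_last_of_gt (F : HNFiltration P.P E) (hE : ¬ IsZero E) {t : ℝ} (h : P.gt t E) :
    t < F.phase (F.n - 1) := by
  by_contra! ht
  have hn := F.n_pos hE
  have h1 := F.tri (j := F.n - 1) (by omega)
  rw [show F.n - 1 + 1 = F.n by omega] at h1
  have h2 : P.gt (F.phase (F.n - 1)) (F.obj (F.n - 1)) :=
    gt_of_hnIoc (F.hnIoc_obj (Nat.sub_le _ _) (u := F.phase 0)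
      (fun i hi => F.phase_lt i _ hi (by omega)) fun i hi => F.phase_le_first (by omega))
  exact F.factor_ne_zero _ (by omega) (isZero_of_P_gt (F.mem_factor _ (by omega))
    (gt_quot h1 (gt_anti ht (gt_iso F.iso.symm h)) h2 (by linarith)))

/-- The orthogonality class does not see the filtration chosen in `Slicing.hn`, so this contains the
well-definedness of φ⁺. -/
lemma phiPlus_le_iff (hE : ¬ IsZero E) {t : ℝ} : P.phiPlus E hE ≤ t ↔ P.le t E := by
  refine ⟨fun h => ?_, first_le_of_le _ hE⟩
  exact le_of_hnIoc ((P.hn E hE).hnIoc (sub_one_lt _) h)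

lemma lt_phiMinus_iff (hE : ¬ IsZero E) {t : ℝ} : t < P.phiMinus E hE ↔ P.gt t E := by
  refine ⟨fun h => ?_, lt_last_of_gt _ hE⟩
  exact gt_of_hnIoc ((P.hn E hE).hnIoc h le_rfl)

/-- Objects of `P((s, u])` are iterated extensions of semistable objects with phases in
`(s, u]`. -/
lemma hnIoc {s u : ℝ} (hs : P.gt s E) (hu : P.le u E) : HNIoc P.P u s E := by
  by_cases hE : IsZero E
  · exact .zero _ _ hE
  · exact (P.hn E hE).hnIoc (lt_last_of_gt _ hE hs) (first_le_of_le _ hE hu)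

lemma exists_bounds (P : Slicing D) (E : D) : ∃ s u, s ≤ u ∧ P.gt s E ∧ P.le u E := by
  by_cases hE : IsZero E
  · exact ⟨0, 0, le_rfl, gt_zero hE, le_zero hE⟩
  · refine ⟨min (P.phiMinus E hE - 1) (P.phiPlus E hE), P.phiPlus E hE, min_le_right _ _, ?_,
      (phiPlus_le_iff hE).1 le_rfl⟩
    exact (lt_phiMinus_iff hE).1 ((min_le_left _ _).trans_lt (sub_one_lt _))

lemma hom_eq_zero_of_gt_le {t : ℝ} {X Y : D} (hX : P.gt t X) (hY : P.le t Y) (f : X ⟶ Y) :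
    f = 0 := by
  obtain ⟨s, u, -, -, hu⟩ := P.exists_bounds X
  exact (hnIoc hX hu).induction (p := fun X => ∀ f : X ⟶ Y, f = 0) (fun X hX f => hX.eq_of_src f 0)
    (fun φ X hφ _ hX => hY φ X hφ hX) (fun _ _ _ h => h.hom_from_eq_zero) f

lemma isZero_of_gt_le {s t : ℝ} {X : D} (hX : P.gt t X) (hY : P.le s X) (hst : s ≤ t) : IsZero X :=
  isZero_of_hom_self (hom_eq_zero_of_gt_le hX (le_mono hst hY))

lemma gt_of_hom {t : ℝ} {X : D} (h : ∀ Y, P.le t Y → ∀ f : X ⟶ Y, f = 0) : P.gt t X :=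
  fun _ F hφ hF => h F (le_of_P hF hφ)

lemma le_of_hom {t : ℝ} {X : D} (h : ∀ Y, P.gt t Y → ∀ f : Y ⟶ X, f = 0) : P.le t X :=
  fun _ F hφ hF => h F (gt_of_P hF hφ)

/-- Semistability in terms of the t-structures. -/
lemma P_iff {φ : ℝ} : P.P φ E ↔ P.le φ E ∧ ∀ s < φ, P.gt s E := by
  refine ⟨fun h => ⟨le_of_P h le_rfl, fun s hs => gt_of_P h hs⟩, fun ⟨h1, h2⟩ => ?_⟩
  by_cases hE : IsZero E
  · exact P.zero_mem φ E hE
  · let F := P.hn E hE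
    have h3 : F.phase 0 ≤ φ := first_le_of_le _ hE h1
    have hn := F.n_pos hE
    have h4 : φ ≤ F.phase (F.n - 1) := le_of_forall_lt fun s hs => lt_last_of_gt _ hE (h2 s hs)
    have h5 : F.n = 1 := by
      by_contra h5
      have := F.phase_lt 0 (F.n - 1) (by omega) (by omega)
      linarith
    have h6 : F.phase 0 = φ := by
      rw [h5] at h4
      exact le_antisymm h3 h4
    obtain ⟨e⟩ := (F.tri hn).nonempty_iso₂₃ F.isZero_obj_zero
    have e' := F.iso
    rw [h5] at e'
    have := F.mem_factor 0 hn
    rw [h6] at this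
    exact P_iso (e.symm ≪≫ e') this

variable [IsTriangulated D]

lemma exists_trunc (P : Slicing D) (t : ℝ) (E : D) : ∃ A B, Tri A E B ∧ P.gt t A ∧ P.le t B := by
  obtain ⟨s, u, -, hs, hu⟩ := P.exists_bounds E
  obtain ⟨A, B, h, hA, hB⟩ := (hnIoc hs hu).exists_tri t
  exact ⟨A, B, h, gt_of_hnIoc hA, le_of_hnIoc hB⟩

end Slicing

end

/-! ### Heights over a line -/

section Height

/-- The signed distance of `z` from the line `ℝ exp(iπt)`. -/
noncomputable def height (t : ℝ) (z : ℂ) : ℝ := z.im * Real.cos (Real.pi * t) - z.re * Real.sin (Real.pi * t)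

lemma height_zero (t : ℝ) : height t 0 = 0 := by simp [height]

lemma height_add (t : ℝ) (z w : ℂ) : height t (z + w) = height t z + height t w := by
  simp only [height, Complex.add_im, Complex.add_re]; ring

lemma height_neg (t : ℝ) (z : ℂ) : height t (-z) = -height t z := by
  simp only [height, Complex.neg_im, Complex.neg_re]; ring

lemma height_add_one (t : ℝ) (z : ℂ) : height (t + 1) z = -height t z := by
  simp only [height, mul_add, mul_one, Real.cos_add_pi, Real.sin_add_pi]; ring

lemma height_exp (t r φ : ℝ) :
    height t ((r : ℂ) * Complex.exp (Complex.I * (Real.pi : ℂ) * (φ : ℂ))) =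
      r * Real.sin (Real.pi * (φ - t)) := by
  have : Complex.I * (Real.pi : ℂ) * (φ : ℂ) = ((Real.pi * φ : ℝ) : ℂ) * Complex.I := by
    push_cast; ring
  rw [this, height, Complex.re_ofReal_mul, Complex.im_ofReal_mul, Complex.exp_ofReal_mul_I_re,
    Complex.exp_ofReal_mul_I_im, mul_sub, Real.sin_sub]
  ring

lemma abs_height_le (t : ℝ) (z : ℂ) : |height t z| ≤ ‖z‖ := by
  rw [← Real.sqrt_sq_eq_abs, Complex.norm_def]
  apply Real.sqrt_le_sqrt
  rw [Complex.normSq_apply, height]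
  nlinarith [sq_nonneg (z.re * Real.cos (Real.pi * t) + z.im * Real.sin (Real.pi * t)),
    Real.sin_sq_add_cos_sq (Real.pi * t)]

lemma continuous_height (z : ℂ) : Continuous fun t => height t z := by
  unfold height; fun_prop

/-- A number on the line `ℝ exp(iπφ)` and in the half plane on its positive side. -/
lemma exists_eq_mul_exp {φ : ℝ} {z : ℂ} (h0 : height φ z = 0) (h1 : 0 < height (φ - 1 / 2) z) :
    ∃ r : ℝ, 0 < r ∧ z = (r : ℂ) * Complex.exp (Complex.I * (Real.pi : ℂ) * (φ : ℂ)) := by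
  refine ⟨height (φ - 1 / 2) z, h1, ?_⟩
  have : Complex.I * (Real.pi : ℂ) * (φ : ℂ) = ((Real.pi * φ : ℝ) : ℂ) * Complex.I := by
    push_cast; ring
  have e1 : height (φ - 1 / 2) z =
      z.im * Real.sin (Real.pi * φ) + z.re * Real.cos (Real.pi * φ) := by
    rw [height, show Real.pi * (φ - 1 / 2) = Real.pi * φ - Real.pi / 2 by ring,
      Real.cos_sub_pi_div_two, Real.sin_sub_pi_div_two]
    ring
  rw [this, e1]
  rw [height] at h0
  have h2 := Real.sin_sq_add_cos_sq (Real.pi * φ)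
  apply Complex.ext
  · rw [Complex.re_ofReal_mul, Complex.exp_ofReal_mul_I_re]
    linear_combination (-z.re) * h2 - Real.sin (Real.pi * φ) * h0
  · rw [Complex.im_ofReal_mul, Complex.exp_ofReal_mul_I_im]
    linear_combination (-z.im) * h2 + Real.cos (Real.pi * φ) * h0

end Height

section

variable {D : Type*} [Category D] [Preadditive D] [HasZeroObject D] [HasShift D ℤ]
  [∀ n : ℤ, (shiftFunctor D n).Additive] [Pretriangulated D]

/-! ### The generalized metric in terms of t-structures -/

namespace Slicing

variable {P Q : Slicing D}

lemma dist_le_iff {ε : ℝ} (hε : 0 ≤ ε) : P.dist Q ≤ ENNReal.ofReal ε ↔ ∀ (E : D) (hE : ¬ IsZero E),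
    |P.phiMinus E hE - Q.phiMinus E hE| ≤ ε ∧ |P.phiPlus E hE - Q.phiPlus E hE| ≤ ε := by
  simp only [dist, iSup_le_iff, max_le_iff, ENNReal.ofReal_le_ofReal_iff hε]

lemma le_of_dist_le {ε t : ℝ} (hε : 0 ≤ ε) (h : P.dist Q ≤ ENNReal.ofReal ε) {E : D}
    (hE : P.le t E) : Q.le (t + ε) E := by
  by_cases h0 : IsZero E
  · exact le_zero h0
  · have h1 := abs_le.1 ((dist_le_iff hε).1 h E h0).2
    have h2 := (phiPlus_le_iff h0).2 hE
    exact (phiPlus_le_iff h0).1 (by linarith)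

lemma gt_of_dist_le {ε t : ℝ} (hε : 0 ≤ ε) (h : P.dist Q ≤ ENNReal.ofReal ε) {E : D}
    (hE : P.gt t E) : Q.gt (t - ε) E := by
  by_cases h0 : IsZero E
  · exact gt_zero h0
  · have h1 := abs_le.1 ((dist_le_iff hε).1 h E h0).1
    have h2 := (lt_phiMinus_iff h0).2 hE
    exact (lt_phiMinus_iff h0).1 (by linarith)

lemma le_of_forall_P {ε : ℝ} (h : ∀ φ E, P.P φ E → Q.le (φ + ε) E) {t : ℝ} {E : D}
    (hE : P.le t E) : Q.le (t + ε) E := by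
  obtain ⟨s, -, -, hs, -⟩ := P.exists_bounds E
  exact (hnIoc hs hE).induction (fun _ => le_zero)
    (fun φ X _ hφ hX => le_mono (by linarith) (h φ X hX)) fun _ _ _ => le_ext

lemma gt_of_forall_P {ε : ℝ} (h : ∀ φ E, P.P φ E → ∀ s < φ, Q.gt (s - ε) E) {t : ℝ} {E : D}
    (hE : P.gt t E) : Q.gt (t - ε) E := by
  obtain ⟨-, u, -, -, hu⟩ := P.exists_bounds E
  exact (hnIoc hE hu).induction (fun _ => gt_zero)
    (fun φ X hφ _ hX => h φ X hX t hφ) fun _ _ _ => gt_ext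

/-- Comparing on semistable objects is enough: the classes of the t-structures are extension closed,
and every object is built from its semistable factors. -/
lemma dist_le_of_forall_P {ε : ℝ} (hε : 0 ≤ ε)
    (h₁ : ∀ φ E, P.P φ E → Q.le (φ + ε) E ∧ ∀ s < φ, Q.gt (s - ε) E)
    (h₂ : ∀ φ E, Q.P φ E → P.le (φ + ε) E ∧ ∀ s < φ, P.gt (s - ε) E) :
    P.dist Q ≤ ENNReal.ofReal ε := by
  refine (dist_le_iff hε).2 fun E hE => ⟨?_, ?_⟩
  · refine abs_sub_le_iff.2 ⟨?_, ?_⟩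
    · rw [sub_le_comm]
      refine le_of_forall_lt fun s hs => (lt_phiMinus_iff hE).2 ?_
      have := gt_of_forall_P (fun φ E hE => (h₁ φ E hE).2)
        ((lt_phiMinus_iff hE).1 (show s + ε < P.phiMinus E hE by linarith))
      rwa [add_sub_cancel_right] at this
    · rw [sub_le_comm]
      refine le_of_forall_lt fun s hs => (lt_phiMinus_iff hE).2 ?_
      have := gt_of_forall_P (fun φ E hE => (h₂ φ E hE).2)
        ((lt_phiMinus_iff hE).1 (show s + ε < Q.phiMinus E hE by linarith))
      rwa [add_sub_cancel_right] at this
  · refine abs_sub_le_iff.2 ⟨?_, ?_⟩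
    · rw [sub_le_iff_le_add, add_comm]
      exact (phiPlus_le_iff hE).2
        (le_of_forall_P (fun φ E hE => (h₂ φ E hE).1) ((phiPlus_le_iff hE).1 le_rfl))
    · rw [sub_le_iff_le_add, add_comm]
      exact (phiPlus_le_iff hE).2
        (le_of_forall_P (fun φ E hE => (h₁ φ E hE).1) ((phiPlus_le_iff hE).1 le_rfl))

lemma eq_of_le_gt (h₁ : ∀ t E, P.le t E ↔ Q.le t E) (h₂ : ∀ t E, P.gt t E ↔ Q.gt t E) : P = Q := by
  ext φ E
  simp only [P_iff, h₁, h₂]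

lemma eq_of_dist_eq_zero (h : P.dist Q = 0) : P = Q := by
  have h1 : P.dist Q ≤ ENNReal.ofReal 0 := by simp [h]
  have h2 : Q.dist P ≤ ENNReal.ofReal 0 := by rw [dist_comm]; exact h1
  refine eq_of_le_gt (fun t E => ⟨fun h => ?_, fun h => ?_⟩) (fun t E => ⟨fun h => ?_, fun h => ?_⟩)
  · simpa using le_of_dist_le le_rfl h1 h
  · simpa using le_of_dist_le le_rfl h2 h
  · simpa using gt_of_dist_le le_rfl h1 h
  · simpa using gt_of_dist_le le_rfl h2 h

end Slicing

/-! ### Weak charges -/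

/-- A function on objects which behaves like the composition of a collection of central charges on
the subquotients of a filtered lattice with the class map. -/
structure IsWeakCharge (w : D → ℂ) : Prop where
  iso : ∀ {X Y : D}, (X ≅ Y) → w X = w Y
  shift : ∀ X : D, w (X⟦(1 : ℤ)⟧) = -w X
  tri : ∀ {A B C : D}, Tri A B C → ∀ {s : ℝ}, 0 < height s (w A) → 0 < height s (w C) →
    w B = w A ∨ w B = w C ∨ w B = w A + w C

namespace IsWeakCharge

variable {w : D → ℂ} (hw : IsWeakCharge w)
include hw

lemma zero {X : D} (hX : IsZero X) : w X = 0 := by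
  have h1 := hw.shift X
  rw [hw.iso ((isZero_shift 1 hX).iso hX)] at h1
  have : (2 : ℂ) * w X = 0 := by linear_combination h1
  simpa using this

lemma not_isZero {X : D} {t : ℝ} (h : 0 < height t (w X)) : ¬ IsZero X := fun h0 => by
  rw [hw.zero h0, height_zero] at h
  exact lt_irrefl _ h

/-- An open half plane is stable under the three alternatives of `tri`, so positivity spreads from
the semistable factors. -/
lemma height_pos {P : Slicing D} {a b s : ℝ}
    (h : ∀ φ X, a < φ → φ ≤ b → P.P φ X → ¬ IsZero X → 0 < height s (w X)) {E : D}
    (ha : P.gt a E) (hb : P.le b E) (hE : ¬ IsZero E) : 0 < height s (w E) :=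
  (Slicing.hnIoc ha hb).induction_ne (p := fun X => 0 < height s (w X)) hE
    (fun X Y e hX => by rwa [← hw.iso e]) h (fun A B C h hA hC => by
      rcases hw.tri h hA hC with h | h | h
      · rwa [h]
      · rwa [h]
      · rw [h, height_add]; exact add_pos hA hC)

/-- The auxiliary half plane at s is what makes `tri` applicable; nonpositivity at t alone would not
exclude cancellation. -/
lemma height_nonpos {P : Slicing D} {a b s t : ℝ}
    (h : ∀ φ X, a < φ → φ ≤ b → P.P φ X → ¬ IsZero X → 0 < height s (w X) ∧ height t (w X) ≤ 0)
    {E : D} (ha : P.gt a E) (hb : P.le b E) : height t (w E) ≤ 0 := by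
  by_cases hE : IsZero E
  · rw [hw.zero hE, height_zero]
  refine ((Slicing.hnIoc ha hb).induction_ne
    (p := fun X => 0 < height s (w X) ∧ height t (w X) ≤ 0) hE
    (fun X Y e hX => by rwa [← hw.iso e]) h (fun A B C h hA hC => ?_)).2
  rcases hw.tri h hA.1 hC.1 with h | h | h
  · rwa [h]
  · rwa [h]
  · rw [h, height_add, height_add]; exact ⟨add_pos hA.1 hC.1, add_nonpos hA.2 hC.2⟩

end IsWeakCharge

/-! ### Uniqueness of the slicing -/

/-- The semistable objects of phase `φ` have positive multiples of `exp(iπφ)` as charges. -/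
def Slicing.HasCharge (P : Slicing D) (w : D → ℂ) : Prop :=
  ∀ (φ : ℝ) (E : D), P.P φ E → ¬ IsZero E →
    ∃ r : ℝ, 0 < r ∧ w E = (r : ℂ) * Complex.exp (Complex.I * (Real.pi : ℂ) * (φ : ℂ))

namespace Slicing

variable {P Q : Slicing D} {w : D → ℂ}

lemma HasCharge.pos (h : P.HasCharge w) {φ t : ℝ} {E : D} (hE : P.P φ E) (h0 : ¬ IsZero E)
    (h1 : t < φ) (h2 : φ < t + 1) : 0 < height t (w E) := by
  obtain ⟨r, hr, e⟩ := h φ E hE h0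
  rw [e, height_exp]
  refine mul_pos hr (Real.sin_pos_of_pos_of_lt_pi ?_ ?_)
  · exact mul_pos Real.pi_pos (by linarith)
  · nlinarith [Real.pi_pos]

lemma HasCharge.nonpos (h : P.HasCharge w) {φ t : ℝ} {E : D} (hE : P.P φ E) (h0 : ¬ IsZero E)
    (h1 : t - 1 ≤ φ) (h2 : φ ≤ t) : height t (w E) ≤ 0 := by
  obtain ⟨r, hr, e⟩ := h φ E hE h0
  rw [e, height_exp]
  refine mul_nonpos_of_nonneg_of_nonpos hr.le (Real.sin_nonpos_of_nonpos_of_neg_pi_le ?_ ?_)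
  · exact mul_nonpos_of_nonneg_of_nonpos Real.pi_pos.le (by linarith)
  · nlinarith [Real.pi_pos]

/-- Otherwise the charge would be strictly above the line at φ according to Q, and not above it
according to P. -/
lemma HasCharge.isZero (hw : IsWeakCharge w) (hP : P.HasCharge w) (hQ : Q.HasCharge w) {φ : ℝ}
    {X : D} (h1 : P.gt (φ - 1 / 4) X) (h2 : P.le φ X) (h3 : Q.gt φ X) (h4 : Q.le (φ + 1 / 4) X) :
    IsZero X := by
  by_contra h0
  have h5 : 0 < height φ (w X) := hw.height_pos
    (fun ψ Y hψ hψ' hY hY0 => hQ.pos hY hY0 hψ (by linarith)) h3 h4 h0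
  have h6 : height φ (w X) ≤ 0 := hw.height_nonpos (s := φ - 1 / 2)
    (fun ψ Y hψ hψ' hY hY0 => ⟨hP.pos hY hY0 (by linarith) (by linarith),
      hP.nonpos hY hY0 (by linarith) hψ'⟩) h1 h2
  linarith

variable [IsTriangulated D]

/-- The part of E that a Q-truncation splits off inherits the P-bound of E, because 1/4 is small
against the shift by 1; `HasCharge.isZero` then kills it. -/
lemma HasCharge.P_le (hw : IsWeakCharge w) (hP : P.HasCharge w) (hQ : Q.HasCharge w)
    (hd : P.dist Q ≤ ENNReal.ofReal (1 / 4)) {φ : ℝ} {E : D} (hE : P.P φ E) : Q.P φ E := by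
  have hd' := hd
  rw [dist_comm] at hd'
  have h4 : (0 : ℝ) ≤ 1 / 4 := by norm_num
  refine P_iff.2 ⟨?_, fun s hs => ?_⟩
  · obtain ⟨A, B, h, hA, hB⟩ := Q.exists_trunc φ E
    have hA1 : P.le φ A := le_sub h (le_of_P hE le_rfl) (le_of_dist_le h4 hd' hB) (by linarith)
    have hA0 : IsZero A := hP.isZero hw hQ (gt_of_dist_le h4 hd' hA) hA1 hA
      (le_of_dist_le h4 hd hA1)
    obtain ⟨e⟩ := h.nonempty_iso₂₃ hA0
    exact le_iso e.symm hB
  · obtain ⟨A, B, h, hA, hB⟩ := Q.exists_trunc s E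
    have hB1 : P.gt s B := gt_quot h (gt_of_P hE hs) (gt_of_dist_le h4 hd' hA) (by linarith)
    have hB0 : IsZero B := hQ.isZero hw hP (gt_of_dist_le h4 hd hB1) hB hB1
      (le_of_dist_le h4 hd' hB)
    obtain ⟨e⟩ := h.nonempty_iso₁₂ hB0
    exact gt_iso e hA

/-- A slicing is determined, among the nearby ones, by its charge. -/
theorem HasCharge.unique (hw : IsWeakCharge w) (hP : P.HasCharge w) (hQ : Q.HasCharge w)
    (hd : P.dist Q ≤ ENNReal.ofReal (1 / 4)) : P = Q := by
  ext φ E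
  have hd' := hd
  rw [dist_comm] at hd'
  exact ⟨hP.P_le hw hQ hd, hQ.P_le hw hP hd'⟩

end Slicing

/-! ### Chain conditions as well-foundedness -/

/-- `A` is a proper strict subobject of `E` in `Q`. -/
def StrictSub (Q : ObjectProperty D) (A E : D) : Prop :=
  ∃ B, Q A ∧ Q E ∧ Q B ∧ ¬ IsZero B ∧ Tri A E B

/-- `B` is a proper strict quotient of `E` in `Q`. -/
def StrictQuot (Q : ObjectProperty D) (B E : D) : Prop :=
  ∃ A, Q A ∧ Q E ∧ Q B ∧ ¬ IsZero A ∧ Tri A E B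

lemma IsFiniteLength.wellFounded_sub {Q : ObjectProperty D} (h : IsFiniteLength Q) :
    WellFounded (StrictSub Q) := by
  rw [wellFounded_iff_isEmpty_descending_chain]
  refine ⟨fun ⟨X, hX⟩ => ?_⟩
  choose B hA hE hB hB0 f g k hT using hX
  obtain ⟨m, hm⟩ := h.artinian X f fun n => ⟨hA n, hE n, B n, g n, k n, hB n, hT n⟩
  exact hB0 m ((Triangle.isZero₃_iff_isIso₁ _ (hT m)).2 (hm m le_rfl))

lemma IsFiniteLength.wellFounded_quot {Q : ObjectProperty D} (h : IsFiniteLength Q) :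
    WellFounded (StrictQuot Q) := by
  rw [wellFounded_iff_isEmpty_descending_chain]
  refine ⟨fun ⟨X, hX⟩ => ?_⟩
  choose A hA hE hB hA0 f g k hT using hX
  obtain ⟨m, hm⟩ := h.noetherian X g fun n => ⟨hE n, hB n, A n, f n, k n, hA n, hT n⟩
  exact hA0 m ((Triangle.isZero₁_iff_isIso₂ _ (hT m)).2 (hm m le_rfl))

lemma IsFiniteLength.anti {Q Q' : ObjectProperty D} (h : IsFiniteLength Q) (hQ : ∀ X, Q' X → Q X) :
    IsFiniteLength Q' where
  artinian X f hf := h.artinian X f fun n => by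
    obtain ⟨h1, h2, C, j, k, h3, h4⟩ := hf n
    exact ⟨hQ _ h1, hQ _ h2, C, j, k, hQ _ h3, h4⟩
  noetherian X f hf := h.noetherian X f fun n => by
    obtain ⟨h1, h2, C, j, k, h3, h4⟩ := hf n
    exact ⟨hQ _ h1, hQ _ h2, C, j, k, hQ _ h3, h4⟩

lemma ExtClosure.of_tri {S : ObjectProperty D} {A B C : D} (h : Tri A B C) (hA : ExtClosure S A)
    (hC : ExtClosure S C) : ExtClosure S B := by
  obtain ⟨f, g, k, h⟩ := h
  exact .ext _ h hA hC

lemma ExtClosure.le_of_le {S : ObjectProperty D} {Q : ObjectProperty D} (h : ∀ X, S X → Q X)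
    (hQ : ∀ A B C, Tri A B C → Q A → Q C → Q B) {X : D} (hX : ExtClosure S X) : Q X := by
  induction hX with
  | of X hX => exact h X hX
  | ext T hT _ _ h1 h3 => exact hQ _ _ _ (Tri.of_dist hT) h1 h3

lemma Slicing.interval_of_gt_le {P : Slicing D} {a b : ℝ} {I : Set ℝ} (hI : Set.Ioc a b ⊆ I)
    (hab : a < b) {X : D} (ha : P.gt a X) (hb : P.le b X) : P.interval I X :=
  (Slicing.hnIoc ha hb).induction
    (fun X hX => .of X ⟨b, hI ⟨hab, le_rfl⟩, P.zero_mem b X hX⟩)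
    (fun φ X h1 h2 hX => .of X ⟨φ, hI ⟨h1, h2⟩, hX⟩) fun _ _ _ => ExtClosure.of_tri

end

/-! ### Deformation of a slicing -/

/-- Addition formulas. This carries signs from the line at t to a nearby line at s. -/
lemma height_eq_rotate (s t : ℝ) (z : ℂ) : height s z =
    Real.cos (Real.pi * (t - s)) * height t z +
      Real.sin (Real.pi * (t - s)) * height (t - 1 / 2) z := by
  have e1 : height (t - 1 / 2) z = z.im * Real.sin (Real.pi * t) + z.re * Real.cos (Real.pi * t) := by
    rw [height, show Real.pi * (t - 1 / 2) = Real.pi * t - Real.pi / 2 by ring,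
      Real.cos_sub_pi_div_two, Real.sin_sub_pi_div_two]
    ring
  have h2 := Real.sin_sq_add_cos_sq (Real.pi * t)
  rw [e1, height, height, mul_sub Real.pi, Real.cos_sub, Real.sin_sub]
  linear_combination (-z.im * Real.cos (Real.pi * s) + z.re * Real.sin (Real.pi * s)) * h2

section

variable {D : Type*} [Category D] [Preadditive D] [HasZeroObject D] [HasShift D ℤ]
  [∀ n : ℤ, (shiftFunctor D n).Additive] [Pretriangulated D]

/-- The charge `w` is close to one for which `P` is the slicing of a stability condition: the charge
of a semistable object of phase `φ` has its phase in `(φ - ε, φ + ε)`. -/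
structure IsDeformation (P : Slicing D) (w : D → ℂ) (ε η : ℝ) : Prop where
  charge : IsWeakCharge w
  pos_eps : 0 < ε
  eps_le : ε ≤ 1 / 16
  lt_eta : 4 * ε < η
  pos : ∀ {φ t : ℝ} {E : D}, P.P φ E → ¬ IsZero E → t + ε ≤ φ → φ ≤ t + 1 - ε → 0 < height t (w E)
  finite : ∀ φ : ℝ, IsFiniteLength (P.interval (Set.Ioo (φ - η) (φ + η)))

/-- Objects all of whose quotients in `P((t - ε, t + ε])` have phase `> t`. -/
def IsTor (P : Slicing D) (w : D → ℂ) (ε t : ℝ) (E : D) : Prop :=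
  P.gt (t - ε) E ∧ ∀ A B, Tri A E B → P.gt (t - 1 / 2) A → P.le (t + ε) B → ¬ IsZero B →
    0 < height t (w B)

/-- Objects all of whose subobjects in `P((t - ε, t + ε])` have phase `≤ t`. -/
def IsFree (P : Slicing D) (w : D → ℂ) (ε t : ℝ) (E : D) : Prop :=
  P.le (t + ε) E ∧ ∀ A B, Tri A E B → P.gt (t - ε) A → P.le (t + 3 / 4) B → height t (w A) ≤ 0

/-- The subcategory `Q((t, ∞))` of the deformed slicing `Q`. -/
def DefGt (P : Slicing D) (w : D → ℂ) (ε t : ℝ) (E : D) : Prop :=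
  ∀ s ≤ t, ∀ F, IsFree P w ε s F → ∀ f : E ⟶ F, f = 0

/-- The subcategory `Q((-∞, t])` of the deformed slicing `Q`. -/
def DefLe (P : Slicing D) (w : D → ℂ) (ε t : ℝ) (E : D) : Prop :=
  ∀ A, DefGt P w ε t A → ∀ f : A ⟶ E, f = 0

/-! ### Orthogonality formalism for the deformed classes -/

section Basic

variable {P : Slicing D} {w : D → ℂ} {ε : ℝ}

lemma DefGt.of_iso {t : ℝ} {X Y : D} (h : DefGt P w ε t X) (e : X ≅ Y) : DefGt P w ε t Y :=
  fun s hs F hF => hom_from_eq_zero_of_iso e (h s hs F hF)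

lemma DefLe.of_iso {t : ℝ} {X Y : D} (h : DefLe P w ε t X) (e : X ≅ Y) : DefLe P w ε t Y :=
  fun A hA => hom_to_eq_zero_of_iso e (h A hA)

lemma DefGt.anti {s t : ℝ} {X : D} (h : DefGt P w ε t X) (hst : s ≤ t) : DefGt P w ε s X :=
  fun r hr => h r (hr.trans hst)

lemma DefLe.mono {s t : ℝ} {X : D} (h : DefLe P w ε s X) (hst : s ≤ t) : DefLe P w ε t X :=
  fun A hA => h A (hA.anti hst)

lemma DefGt.ext {t : ℝ} {A B C : D} (h : Tri A B C) (hA : DefGt P w ε t A)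
    (hC : DefGt P w ε t C) : DefGt P w ε t B :=
  fun s hs F hF => h.hom_from_eq_zero (hA s hs F hF) (hC s hs F hF)

lemma DefLe.ext {t : ℝ} {A B C : D} (h : Tri A B C) (hA : DefLe P w ε t A)
    (hC : DefLe P w ε t C) : DefLe P w ε t B :=
  fun F hF => h.hom_to_eq_zero (hA F hF) (hC F hF)

lemma DefGt.of_isZero {t : ℝ} {X : D} (h : IsZero X) : DefGt P w ε t X :=
  fun _ _ _ _ f => h.eq_of_src f 0

lemma DefLe.of_isZero {t : ℝ} {X : D} (h : IsZero X) : DefLe P w ε t X :=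
  fun _ _ f => h.eq_of_tgt f 0

lemma IsFree.defLe {t : ℝ} {X : D} (h : IsFree P w ε t X) : DefLe P w ε t X :=
  fun _ hA => hA t le_rfl X h

lemma DefGt.isZero {s t : ℝ} {X : D} (h : DefGt P w ε t X) (h' : DefLe P w ε s X) (hst : s ≤ t) :
    IsZero X :=
  isZero_of_hom_self (h' X (h.anti hst))

lemma DefGt.of_gt {t : ℝ} {X : D} (h : P.gt (t + ε) X) : DefGt P w ε t X :=
  fun _ hs _ hF => Slicing.hom_eq_zero_of_gt_le h (Slicing.le_mono (by linarith) hF.1)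

lemma DefLe.le {t : ℝ} {X : D} (h : DefLe P w ε t X) : P.le (t + ε) X :=
  Slicing.le_of_hom fun Y hY => h Y (.of_gt hY)

end Basic

variable {P : Slicing D} {w : D → ℂ} {ε η : ℝ}

/-! ### The deformed t-structures -/

namespace IsDeformation

variable (h : IsDeformation P w ε η)
include h

lemma height_pos {a b t : ℝ} {E : D} (ha : P.gt a E) (hb : P.le b E) (hta : t + ε ≤ a)
    (htb : b ≤ t + 1 - ε) (hE : ¬ IsZero E) : 0 < height t (w E) :=
  h.charge.height_pos (fun _ _ h1 h2 hX h0 => h.pos hX h0 (by linarith) (by linarith)) ha hb hE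

lemma height_nonpos {a b t : ℝ} {E : D} (ha : P.gt a E) (hb : P.le b E) (hta : t - 1 + ε ≤ a)
    (htb : b ≤ t - ε) : height t (w E) ≤ 0 := by
  by_cases hE : IsZero E
  · rw [h.charge.zero hE, height_zero]
  · have := h.height_pos ha hb hta (by linarith) hE
    rw [← sub_add_cancel t 1, height_add_one]
    linarith

/-- An interval of length at most 1 - 2ε leaves room for phases moving by ε, so all charges involved
lie in the half plane at a - ε. -/
lemma charge_tri {a b : ℝ} {A B C : D} (hT : Tri A B C) (hA : P.gt a A) (hA' : P.le b A)
    (hC : P.gt a C) (hC' : P.le b C) (hab : b ≤ a + 1 - 2 * ε) :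
    w B = w A ∨ w B = w C ∨ w B = w A + w C := by
  by_cases hA0 : IsZero A
  · obtain ⟨e⟩ := hT.nonempty_iso₂₃ hA0
    exact .inr (.inl (h.charge.iso e))
  by_cases hC0 : IsZero C
  · obtain ⟨e⟩ := hT.nonempty_iso₁₂ hC0
    exact .inl (h.charge.iso e.symm)
  exact h.charge.tri hT (s := a - ε) (h.height_pos hA hA' (by linarith) (by linarith) hA0)
    (h.height_pos hC hC' (by linarith) (by linarith) hC0)

lemma charge_shift_neg (X : D) : w (X⟦(-1 : ℤ)⟧) = -w X := by
  have := h.charge.shift (X⟦(-1 : ℤ)⟧)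
  rw [h.charge.iso (shiftNegShift X (1 : ℤ))] at this
  rw [this, neg_neg]

lemma isFree_shift {t : ℝ} {F : D} (hF : IsFree P w ε t F) :
    IsFree P w ε (t + 1) (F⟦(1 : ℤ)⟧) := by
  refine ⟨Slicing.le_mono (by linarith) (Slicing.le_shift hF.1), fun A B hT hA hB => ?_⟩
  have := hF.2 _ _ ((hT.shift (-1)).congr (Iso.refl _) (shiftShiftNeg F (1 : ℤ)) (Iso.refl _))
    (Slicing.gt_anti (by linarith) (Slicing.gt_shift_neg hA))
    (Slicing.le_mono (by linarith) (Slicing.le_shift_neg hB))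
  rwa [h.charge_shift_neg, height_neg, ← height_add_one] at this

lemma isFree_shift_neg {t : ℝ} {F : D} (hF : IsFree P w ε t F) :
    IsFree P w ε (t - 1) (F⟦(-1 : ℤ)⟧) := by
  refine ⟨Slicing.le_mono (by linarith) (Slicing.le_shift_neg hF.1), fun A B hT hA hB => ?_⟩
  have := hF.2 _ _ ((hT.shift 1).congr (Iso.refl _) (shiftNegShift F (1 : ℤ)) (Iso.refl _))
    (Slicing.gt_anti (by linarith) (Slicing.gt_shift hA))
    (Slicing.le_mono (by linarith) (Slicing.le_shift hB))
  rw [h.charge.shift, height_neg, ← height_add_one] at this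
  have e := height_add_one (t - 1 + 1) (w A)
  rw [height_add_one (t - 1)] at e
  rw [sub_add_cancel] at e
  linarith

lemma defGt_shift {t : ℝ} {X : D} (hX : DefGt P w ε t X) : DefGt P w ε (t + 1) (X⟦(1 : ℤ)⟧) :=
  fun s hs _ hF => shift_hom_from 1 (hX (s - 1) (by linarith) _ (h.isFree_shift_neg hF))

lemma defGt_shift_neg {t : ℝ} {X : D} (hX : DefGt P w ε t X) :
    DefGt P w ε (t - 1) (X⟦(-1 : ℤ)⟧) :=
  fun s hs _ hF => shift_hom_from (-1) (hX (s + 1) (by linarith) _ (h.isFree_shift hF))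

lemma defLe_shift {t : ℝ} {X : D} (hX : DefLe P w ε t X) : DefLe P w ε (t + 1) (X⟦(1 : ℤ)⟧) :=
  fun A hA => shift_hom_to 1 (hX _ (by simpa using h.defGt_shift_neg hA))

lemma defLe_shift_neg {t : ℝ} {X : D} (hX : DefLe P w ε t X) :
    DefLe P w ε (t - 1) (X⟦(-1 : ℤ)⟧) :=
  fun A hA => shift_hom_to (-1) (hX _ (by simpa using h.defGt_shift hA))

lemma defGt_quot {s t : ℝ} {A B C : D} (hT : Tri A B C) (hB : DefGt P w ε t B)
    (hA : DefGt P w ε s A) (hst : t ≤ s + 1) : DefGt P w ε t C :=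
  .ext hT.rotate hB ((h.defGt_shift hA).anti hst)

lemma defLe_sub {s t : ℝ} {A B C : D} (hT : Tri A B C) (hB : DefLe P w ε t B)
    (hC : DefLe P w ε s C) (hst : s - 1 ≤ t) : DefLe P w ε t A :=
  .ext hT.invRotate ((h.defLe_shift_neg hC).mono hst) hB

/-- The relevant subobjects vanish. Together with `DefGt.of_gt` this shows that P and Q differ only
inside a window of radius ε. -/
lemma isFree_of_le {t : ℝ} {X : D} (hX : P.le (t - ε) X) : IsFree P w ε t X := by
  have h1 := h.pos_eps
  have h2 := h.eps_le
  refine ⟨Slicing.le_mono (by linarith) hX, fun A B hT hA hB => ?_⟩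
  have := Slicing.isZero_of_gt_le hA (Slicing.le_sub hT hX hB (by linarith)) le_rfl
  rw [h.charge.zero this, height_zero]

lemma defLe_of_le {t : ℝ} {X : D} (hX : P.le (t - ε) X) : DefLe P w ε t X :=
  (h.isFree_of_le hX).defLe

lemma gt_of_defGt {t : ℝ} {X : D} (hX : DefGt P w ε t X) : P.gt (t - ε) X :=
  Slicing.gt_of_hom fun Y hY => hX t le_rfl Y (h.isFree_of_le hY)

lemma interval {t : ℝ} {X : D} (h1 : P.gt (t - 3 * ε) X) (h2 : P.le (t + 3 * ε) X) :
    P.interval (Set.Ioo (t - η) (t + η)) X := by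
  have h3 := h.pos_eps
  have h4 := h.lt_eta
  exact Slicing.interval_of_gt_le (a := t - 3 * ε) (b := t + 3 * ε)
    (fun x hx => Set.mem_Ioo.2 ⟨by linarith [hx.1], by linarith [hx.2]⟩) (by linarith) h1 h2

lemma interval' {t : ℝ} {X : D} (h1 : P.gt (t - ε) X) (h2 : P.le (t + ε) X) :
    P.interval (Set.Ioo (t - η) (t + η)) X := by
  have h3 := h.pos_eps
  exact h.interval (Slicing.gt_anti (by linarith) h1) (Slicing.le_mono (by linarith) h2)

variable [IsTriangulated D]

/-- The image of f would be a quotient of T and a subobject of F, with contradictory signs of its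
height. For t > s + 2ε the P-phases alone separate T from F. -/
lemma hom_eq_zero {s t : ℝ} (hst : s ≤ t) {T F : D} (hT : IsTor P w ε t T)
    (hF : IsFree P w ε s F) (f : T ⟶ F) : f = 0 := by
  have h1 := h.pos_eps
  have h2 := h.eps_le
  rcases lt_or_ge (s + 2 * ε) t with hlt | hle
  · exact Slicing.hom_eq_zero_of_gt_le (Slicing.gt_anti (by linarith) hT.1) hF.1 f
  obtain ⟨C, g, k, hd⟩ := distinguished_cocone_triangle f
  -- Truncating the cone at t + 1/2 produces the image I, as in a heart: I ⟶ F ⟶ C₂ and C₁[-1] ⟶ T ⟶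
  -- I are triangles.
  obtain ⟨C₁, C₂, ⟨f', g', k', hd'⟩, hC₁, hC₂⟩ := P.exists_trunc (t + 1 / 2) C
  obtain ⟨I, i, l, hI, hI'⟩ := exists_comp_quot hd hd'
  have hI2 : Tri I F C₂ := ⟨_, _, _, hI⟩
  have hIle : P.le (s + ε) I := Slicing.le_sub hI2 hF.1 hC₂ (by linarith)
  have hIgt : P.gt (t - ε) I := Slicing.gt_ext hI' hT.1 (Slicing.gt_anti (by linarith) hC₁)
  have hI0 : IsZero I := by
    by_contra hI0
    have p1 : 0 < height t (w I) := hT.2 _ _ hI'.invRotate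
      (Slicing.gt_anti (by linarith) (Slicing.gt_shift_neg hC₁))
      (Slicing.le_mono (by linarith) hIle) hI0
    have p2 : height s (w I) ≤ 0 := hF.2 _ _ hI2 (Slicing.gt_anti (by linarith) hIgt)
      (Slicing.le_mono (by linarith) hC₂)
    have p3 : 0 < height (t - 1 / 2) (w I) := h.height_pos hIgt hIle (by linarith) (by linarith) hI0
    have p4 : 0 < Real.cos (Real.pi * (t - s)) := by
      refine Real.cos_pos_of_mem_Ioo ⟨?_, ?_⟩ <;> nlinarith [Real.pi_pos]
    have p5 : 0 ≤ Real.sin (Real.pi * (t - s)) := by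
      refine Real.sin_nonneg_of_nonneg_of_le_pi ?_ ?_ <;> nlinarith [Real.pi_pos]
    -- Positive heights at t and at t - 1/2 force a positive height at s, as 0 ≤ t - s ≤ 2ε.
    rw [height_eq_rotate s t] at p2
    nlinarith [mul_pos p4 p1, mul_nonneg p5 p3.le]
  have hfg : f ≫ g = 0 := comp_distTriang_mor_zero₁₂ _ hd
  have : IsIso (g ≫ g') := (Triangle.isZero₁_iff_isIso₂ _ hI).1 hI0
  rw [← cancel_mono (g ≫ g'), reassoc_of% hfg, zero_comp, zero_comp]

lemma defGt_of_isTor {t : ℝ} {T : D} (hT : IsTor P w ε t T) : DefGt P w ε t T :=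
  fun _ hs _ hF => h.hom_eq_zero hs hT hF

/-- A destabilizing subobject is enlarged until its quotient lies in the window: the part B₁ of the
quotient with phases in (t + ε, t + 3/4] has positive height and moves into the subobject. The bound
3/4 is large enough for `hom_eq_zero`, which needs 1/2 + 2ε, and small enough for this step, which
needs 1 - ε. -/
lemma exists_sub {t : ℝ} {E : D} (h1 : P.gt (t - ε) E) (h2 : P.le (t + ε) E)
    (hE : ¬ IsFree P w ε t E) : ∃ A B, Tri A E B ∧ (P.gt (t - ε) A ∧ P.le (t + ε) A) ∧
      (P.gt (t - ε) B ∧ P.le (t + ε) B) ∧ 0 < height t (w A) := by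
  have e1 := h.pos_eps
  have e2 := h.eps_le
  have : ∃ A B, Tri A E B ∧ P.gt (t - ε) A ∧ P.le (t + 3 / 4) B ∧ 0 < height t (w A) := by
    by_contra! hc
    exact hE ⟨h2, fun A B hT hA hB => hc A B hT hA hB⟩
  obtain ⟨A, B, hT, hA, hB, hpos⟩ := this
  have hA' : P.le (t + ε) A := Slicing.le_sub hT h2 hB (by linarith)
  have hB' : P.gt (t - ε) B := Slicing.gt_quot hT h1 hA (by linarith)
  obtain ⟨B₁, B₂, hTB, hB₁, hB₂⟩ := P.exists_trunc (t + ε) B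
  obtain ⟨A', hT', hTA⟩ := hT.comp_quot hTB
  have hB₂' : P.gt (t - ε) B₂ := Slicing.gt_quot hTB hB' hB₁ (by linarith)
  have hB₁' : P.le (t + 3 / 4) B₁ := Slicing.le_sub hTB hB hB₂ (by linarith)
  refine ⟨A', B₂, hT', ⟨Slicing.gt_ext hTA hA (Slicing.gt_anti (by linarith) hB₁),
    Slicing.le_sub hT' h2 hB₂ (by linarith)⟩, ⟨hB₂', hB₂⟩, ?_⟩
  by_cases hB0 : IsZero B₁
  · obtain ⟨e⟩ := hTA.nonempty_iso₁₂ hB0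
    rwa [← h.charge.iso e]
  · have hp := h.height_pos hB₁ hB₁' le_rfl (by linarith) hB0
    rcases h.charge_tri hTA hA (Slicing.le_mono (by linarith) hA')
      (Slicing.gt_anti (by linarith) hB₁) hB₁' (by linarith) with e | e | e
    · rwa [e]
    · rwa [e]
    · rw [e, height_add]; linarith

/-- Dual to `exists_sub`: the part of the kernel with phases at most t - ε has nonpositive height
and is moved into the quotient. -/
lemma exists_quot {t : ℝ} {E : D} (h1 : P.gt (t - ε) E) (h2 : P.le (t + ε) E)
    (hE : ¬ IsTor P w ε t E) : ∃ A B, Tri A E B ∧ (P.gt (t - ε) A ∧ P.le (t + ε) A) ∧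
      (P.gt (t - ε) B ∧ P.le (t + ε) B) ∧ ¬ IsZero B ∧ height t (w B) ≤ 0 := by
  have e1 := h.pos_eps
  have e2 := h.eps_le
  have : ∃ A B, Tri A E B ∧ P.gt (t - 1 / 2) A ∧ P.le (t + ε) B ∧ ¬ IsZero B ∧
      height t (w B) ≤ 0 := by
    by_contra! hc
    exact hE ⟨h1, fun A B hT hA hB => hc A B hT hA hB⟩
  obtain ⟨A, B, hT, hA, hB, hB0, hneg⟩ := this
  have hA' : P.le (t + ε) A := Slicing.le_sub hT h2 hB (by linarith)
  have hB' : P.gt (t - ε) B := Slicing.gt_quot hT h1 hA (by linarith)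
  obtain ⟨A₁, A₂, hTA, hA₁, hA₂⟩ := P.exists_trunc (t - ε) A
  obtain ⟨B', hT', hTB⟩ := hT.comp_sub hTA
  have hA₂' : P.gt (t - 1 / 2) A₂ := Slicing.gt_quot hTA hA hA₁ (by linarith)
  have hA₁' : P.le (t + ε) A₁ := Slicing.le_sub hTA hA' hA₂ (by linarith)
  refine ⟨A₁, B', hT', ⟨hA₁, hA₁'⟩, ⟨Slicing.gt_quot hT' h1 hA₁ (by linarith),
    Slicing.le_ext hTB (Slicing.le_mono (by linarith) hA₂) hB⟩, fun hB'0 => hB0 ?_, ?_⟩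
  · exact Slicing.isZero_of_gt_le (t := t + ε)
      (Slicing.gt_quot hTB (Slicing.gt_zero hB'0) hA₂' (by linarith)) hB le_rfl
  · have hp := h.height_nonpos hA₂' hA₂ (by linarith) le_rfl
    rcases h.charge_tri hTB hA₂' (Slicing.le_mono (by linarith) hA₂)
      (Slicing.gt_anti (by linarith) hB') hB (by linarith) with e | e | e
    · rwa [e]
    · rwa [e]
    · rw [e, height_add]; linarith

/-- If E is not torsion, it has a quotient of nonpositive height; the kernel must then have positive
height, and the descent ends by the artinian condition. -/
lemma exists_tor_sub {t : ℝ} {E : D} (h1 : P.gt (t - ε) E) (h2 : P.le (t + ε) E)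
    (hpos : 0 < height t (w E)) : ∃ T B, Tri T E B ∧ ¬ IsZero T ∧ (P.gt (t - ε) T ∧ P.le (t + ε) T) ∧
      (P.gt (t - ε) B ∧ P.le (t + ε) B) ∧ IsTor P w ε t T := by
  have e1 := h.pos_eps
  have e2 := h.eps_le
  induction E using (h.finite t).wellFounded_sub.induction with
  | _ E ih =>
    by_cases hE : IsTor P w ε t E
    · obtain ⟨Z, hZ⟩ := (inferInstance : HasZeroObject D).zero
      exact ⟨E, Z, tri_zero_right hZ E, h.charge.not_isZero hpos, ⟨h1, h2⟩,
        ⟨Slicing.gt_zero hZ, Slicing.le_zero hZ⟩, hE⟩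
    · obtain ⟨A, B, hT, hA, hB, hB0, hneg⟩ := h.exists_quot h1 h2 hE
      have hApos : 0 < height t (w A) := by
        rcases h.charge_tri hT hA.1 hA.2 hB.1 hB.2 (by linarith) with e | e | e
        · rwa [← e]
        · rw [e] at hpos; linarith
        · rw [e, height_add] at hpos; linarith
      obtain ⟨T, C, hTC, hT0, hTw, hCw, hTor⟩ := ih A ⟨B, h.interval' hA.1 hA.2, h.interval' h1 h2,
        h.interval' hB.1 hB.2, hB0, hT⟩ hA.1 hA.2 hApos
      obtain ⟨B', hT', hC⟩ := hT.comp_sub hTC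
      exact ⟨T, B', hT', hT0, hTw, ⟨Slicing.gt_ext hC hCw.1 hB.1, Slicing.le_ext hC hCw.2 hB.2⟩, hTor⟩

/-- Dual descent: split off subobjects of positive height, using the noetherian condition. -/
lemma exists_free_quot {t : ℝ} {E : D} (h1 : P.gt (t - ε) E) (h2 : P.le (t + ε) E)
    (hE0 : ¬ IsZero E) (hneg : height t (w E) ≤ 0) :
    ∃ A F, Tri A E F ∧ ¬ IsZero F ∧ P.gt (t - ε) A ∧ IsFree P w ε t F := by
  have e1 := h.pos_eps
  have e2 := h.eps_le
  induction E using (h.finite t).wellFounded_quot.induction with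
  | _ E ih =>
    by_cases hE : IsFree P w ε t E
    · obtain ⟨Z, hZ⟩ := (inferInstance : HasZeroObject D).zero
      exact ⟨Z, E, tri_zero_left hZ E, hE0, Slicing.gt_zero hZ, hE⟩
    · obtain ⟨A, B, hT, hA, hB, hpos⟩ := h.exists_sub h1 h2 hE
      have hBneg : height t (w B) ≤ 0 := by
        rcases h.charge_tri hT hA.1 hA.2 hB.1 hB.2 (by linarith) with e | e | e
        · rw [e] at hneg; linarith
        · rwa [← e]
        · rw [e, height_add] at hneg; linarith
      have hB0 : ¬ IsZero B := fun hB0 => by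
        obtain ⟨e⟩ := hT.nonempty_iso₁₂ hB0
        rw [h.charge.iso e] at hpos
        linarith
      obtain ⟨C, F, hTC, hF0, hCw, hF⟩ := ih B ⟨A, h.interval' hA.1 hA.2, h.interval' h1 h2,
        h.interval' hB.1 hB.2, h.charge.not_isZero hpos, hT⟩ hB.1 hB.2 hB0 hBneg
      obtain ⟨A', hT', hC⟩ := hT.comp_quot hTC
      exact ⟨A', F, hT', hF0, Slicing.gt_ext hC hA.1 hCw, hF⟩

/-- Torsion subobjects are split off until the quotient is free. The kernel is only an iterated
extension of torsion objects, which suffices because `DefGt` is an orthogonal and hence extension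
closed. -/
lemma exists_trunc_window {t : ℝ} {E : D} (h1 : P.gt (t - ε) E) (h2 : P.le (t + ε) E) :
    ∃ T F, Tri T E F ∧ DefGt P w ε t T ∧ DefLe P w ε t F := by
  induction E using (h.finite t).wellFounded_quot.induction with
  | _ E ih =>
    by_cases hE : IsFree P w ε t E
    · obtain ⟨Z, hZ⟩ := (inferInstance : HasZeroObject D).zero
      exact ⟨Z, E, tri_zero_left hZ E, .of_isZero hZ, hE.defLe⟩
    · obtain ⟨A, B, hT, hA, hB, hpos⟩ := h.exists_sub h1 h2 hE
      obtain ⟨T, C, hTC, hT0, hTw, hCw, hTor⟩ := h.exists_tor_sub hA.1 hA.2 hpos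
      obtain ⟨B', hT', hC⟩ := hT.comp_sub hTC
      have hB' : P.gt (t - ε) B' ∧ P.le (t + ε) B' :=
        ⟨Slicing.gt_ext hC hCw.1 hB.1, Slicing.le_ext hC hCw.2 hB.2⟩
      obtain ⟨T', F, hTF, hT'gt, hF⟩ := ih B' ⟨T, h.interval' hTw.1 hTw.2, h.interval' h1 h2,
        h.interval' hB'.1 hB'.2, hT0, hT'⟩ hB'.1 hB'.2
      obtain ⟨T'', hT'', hTT⟩ := hT'.comp_quot hTF
      exact ⟨T'', F, hT'', .ext hTT (h.defGt_of_isTor hTor) hT'gt, hF⟩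

/-- Above t + ε and below t - ε the P-truncations already serve; only the middle piece needs the
window. -/
lemma exists_trunc (t : ℝ) (E : D) : ∃ T F, Tri T E F ∧ DefGt P w ε t T ∧ DefLe P w ε t F := by
  have e1 := h.pos_eps
  have e2 := h.eps_le
  obtain ⟨E₁, E', hT, hE₁, hE'⟩ := P.exists_trunc (t + ε) E
  obtain ⟨E₀, E₂, hT', hE₀, hE₂⟩ := P.exists_trunc (t - ε) E'
  obtain ⟨T, F, hTF, hTgt, hF⟩ := h.exists_trunc_window hE₀
    (Slicing.le_sub hT' hE' hE₂ (by linarith))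
  obtain ⟨B, hB, hFB⟩ := hT'.comp_sub hTF
  obtain ⟨A, hA, hEA⟩ := hT.comp_quot hB
  exact ⟨A, B, hA, .ext hEA (.of_gt hE₁) hTgt, .ext hFB hF (h.defLe_of_le hE₂)⟩

/-- The part inside the window cannot have nonpositive height: it would have a nonzero free
quotient, which would lie both in `DefGt` and in `DefLe`. -/
lemma height_pos_of_defGt {t : ℝ} {E : D} (hE : DefGt P w ε t E) (hE' : P.le (t + 2 * ε) E)
    (hE0 : ¬ IsZero E) : 0 < height t (w E) := by
  have e1 := h.pos_eps
  have e2 := h.eps_le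
  obtain ⟨E₁, B, hT, hE₁, hB⟩ := P.exists_trunc (t + ε) E
  have hBgt : DefGt P w ε t B := h.defGt_quot hT hE (.of_gt hE₁) (by linarith)
  have hB' := h.gt_of_defGt hBgt
  have hE₁' : P.le (t + 2 * ε) E₁ := Slicing.le_sub hT hE' hB (by linarith)
  have hBpos : ¬ IsZero B → 0 < height t (w B) := by
    intro hB0
    by_contra! hneg
    obtain ⟨A, F, hF, hF0, hA, hFf⟩ := h.exists_free_quot hB' hB hB0 hneg
    refine hF0 ((DefGt.ext hF.rotate hBgt ?_).isZero hFf.defLe le_rfl)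
    exact .of_gt (Slicing.gt_anti (by linarith) (Slicing.gt_shift hA))
  by_cases hB0 : IsZero B
  · obtain ⟨e⟩ := hT.nonempty_iso₁₂ hB0
    exact h.height_pos (Slicing.gt_iso e hE₁) hE' le_rfl (by linarith) hE0
  by_cases hE10 : IsZero E₁
  · obtain ⟨e⟩ := hT.nonempty_iso₂₃ hE10
    rw [h.charge.iso e]
    exact hBpos hB0
  have p1 := hBpos hB0
  have p2 := h.height_pos hE₁ hE₁' le_rfl (by linarith) hE10
  rcases h.charge_tri hT (Slicing.gt_anti (by linarith) hE₁) hE₁' hB'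
    (Slicing.le_mono (by linarith) hB) (by linarith) with e | e | e
  · rwa [e]
  · rwa [e]
  · rw [e, height_add]; linarith

lemma height_nonpos_of_defLe {t : ℝ} {E : D} (hE : DefLe P w ε t E) (hE' : P.gt (t - 2 * ε) E) :
    height t (w E) ≤ 0 := by
  have e1 := h.pos_eps
  have e2 := h.eps_le
  obtain ⟨A, B, hT, hA, hB⟩ := P.exists_trunc (t - ε) E
  have hAle : DefLe P w ε t A := h.defLe_sub hT hE (h.defLe_of_le hB) (by linarith)
  have hA' := hAle.le
  have hB' : P.gt (t - 2 * ε) B := Slicing.gt_quot hT hE' hA (by linarith)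
  have p1 : height t (w A) ≤ 0 := by
    by_contra! hpos
    obtain ⟨T, C, hTC, hT0, -, hC, hTor⟩ := h.exists_tor_sub hA hA' hpos
    refine hT0 ((h.defGt_of_isTor hTor).isZero (DefLe.ext hTC.invRotate ?_ hAle) le_rfl)
    exact h.defLe_of_le (Slicing.le_mono (by linarith) (Slicing.le_shift_neg hC.2))
  have p2 := h.height_nonpos hB' hB (by linarith) le_rfl
  rcases h.charge_tri hT (Slicing.gt_anti (by linarith) hA) hA' hB'
    (Slicing.le_mono (by linarith) hB) (by linarith) with e | e | e
  · rwa [e]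
  · rwa [e]
  · rw [e, height_add]; linarith

/-- Right continuity: a nonzero truncation T would have positive height at t, while its heights at s
> t are nonpositive and tend to the height at t. -/
lemma defLe_of_forall_gt {t : ℝ} {E : D} (hE : ∀ s > t, DefLe P w ε s E) : DefLe P w ε t E := by
  have e1 := h.pos_eps
  have e2 := h.eps_le
  obtain ⟨T, F, hT, hTgt, hF⟩ := h.exists_trunc t E
  have hTle : ∀ s > t, DefLe P w ε s T := fun s hs =>
    h.defLe_sub hT (hE s hs) hF (by linarith)
  by_cases hT0 : IsZero T
  · obtain ⟨e⟩ := hT.nonempty_iso₂₃ hT0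
    exact hF.of_iso e.symm
  exfalso
  have p1 : 0 < height t (w T) := h.height_pos_of_defGt hTgt
    (Slicing.le_mono (by linarith) (hTle (t + ε) (by linarith)).le) hT0
  have p2 : height t (w T) ≤ 0 := by
    refine le_of_tendsto ((continuous_height (w T)).continuousWithinAt (s := Set.Ioi t) (x := t)) ?_
    filter_upwards [Ioo_mem_nhdsGT (show t < t + ε by linarith)] with s hs
    exact h.height_nonpos_of_defLe (hTle s hs.1)
      (Slicing.gt_anti (by linarith [hs.2]) (h.gt_of_defGt hTgt))
  linarith

end IsDeformation

/-- The semistable objects of the deformed slicing. -/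
def DefP (P : Slicing D) (w : D → ℂ) (ε φ : ℝ) (E : D) : Prop :=
  DefLe P w ε φ E ∧ ∀ s < φ, DefGt P w ε s E

/-! ### The deformed slicing and its Harder-Narasimhan filtrations -/

namespace IsDeformation

variable [IsTriangulated D] (h : IsDeformation P w ε η)
include h

lemma gt_of_defP {φ : ℝ} {E : D} (hE : DefP P w ε φ E) : P.gt (φ - 2 * ε) E := by
  have e1 := h.pos_eps
  exact Slicing.gt_anti (by linarith) (h.gt_of_defGt (hE.2 (φ - ε) (by linarith)))

/-- The height at φ is nonpositive by `DefLe` and a limit of positive heights from the left, so it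
is zero; the height at φ - 1/2 selects the positive ray. -/
lemma charge_defP {φ : ℝ} {E : D} (hE : DefP P w ε φ E) (hE0 : ¬ IsZero E) :
    ∃ r : ℝ, 0 < r ∧ w E = (r : ℂ) * Complex.exp (Complex.I * (Real.pi : ℂ) * (φ : ℂ)) := by
  have e1 := h.pos_eps
  have e2 := h.eps_le
  refine exists_eq_mul_exp (le_antisymm (h.height_nonpos_of_defLe hE.1 (h.gt_of_defP hE)) ?_)
    (h.height_pos (h.gt_of_defP hE) hE.1.le (by linarith) (by linarith) hE0)
  refine ge_of_tendsto ((continuous_height (w E)).continuousWithinAt (s := Set.Iio φ) (x := φ)) ?_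
  filter_upwards [Ioo_mem_nhdsLT (show φ - ε < φ by linarith)] with s hs
  exact (h.height_pos_of_defGt (hE.2 s hs.2) (Slicing.le_mono (by linarith [hs.1]) hE.1.le) hE0).le

/-- Phases do not accumulate at t₀ from above: by right continuity something nonzero can be split
off at some t > t₀, and the noetherian condition ends the process. -/
lemma exists_trunc_discrete {c t₀ : ℝ} (hc : c - ε ≤ t₀) {X : D} (h1 : DefGt P w ε (c - ε) X)
    (h2 : DefLe P w ε (c + ε) X) :
    ∃ t' > t₀, ∃ A B, Tri A X B ∧ DefGt P w ε t' A ∧ DefLe P w ε t₀ B := by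
  have e1 := h.pos_eps
  have e2 := h.eps_le
  have hint : ∀ {Y : D}, DefGt P w ε (c - ε) Y → DefLe P w ε (c + ε) Y →
      P.interval (Set.Ioo (c - η) (c + η)) Y := fun hY hY' =>
    h.interval (Slicing.gt_anti (by linarith) (h.gt_of_defGt hY)) (Slicing.le_mono (by linarith) hY'.le)
  induction X using (h.finite c).wellFounded_quot.induction with
  | _ X ih =>
    by_cases hX : DefLe P w ε t₀ X
    · obtain ⟨Z, hZ⟩ := (inferInstance : HasZeroObject D).zero
      exact ⟨t₀ + 1, by linarith, Z, X, tri_zero_left hZ X, .of_isZero hZ, hX⟩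
    · have : ∃ t > t₀, ¬ DefLe P w ε t X := by
        by_contra! hc
        exact hX (h.defLe_of_forall_gt hc)
      obtain ⟨t, ht, hXt⟩ := this
      have htc : t < c + ε := by
        by_contra! hc
        exact hXt (h2.mono hc)
      obtain ⟨A, X', hT, hA, hX'⟩ := h.exists_trunc t X
      have hX'1 : DefGt P w ε (c - ε) X' := h.defGt_quot hT h1 hA (by linarith)
      have hX'2 := hX'.mono htc.le
      have hA2 : DefLe P w ε (c + ε) A := h.defLe_sub hT h2 hX' (by linarith)
      have hA0 : ¬ IsZero A := fun hA0 => by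
        obtain ⟨e⟩ := hT.nonempty_iso₂₃ hA0
        exact hXt (hX'.of_iso e.symm)
      obtain ⟨t', ht', A', B, hT', hA', hB⟩ := ih X' ⟨A, hint (hA.anti (by linarith)) hA2,
        hint h1 h2, hint hX'1 hX'2, hA0, hT⟩ hX'1 hX'2
      obtain ⟨A'', hT'', hAA⟩ := hT.comp_quot hT'
      exact ⟨min t t', lt_min ht ht', A'', B, hT'',
        .ext hAA (hA.anti (min_le_left _ _)) (hA'.anti (min_le_right _ _)), hB⟩

/-- The last semistable quotient is split off and the argument repeated on the kernel, which
terminates by the artinian condition. -/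
lemma hnIoc_window {c s : ℝ} (hc : c - ε ≤ s) {X : D} (h1 : DefGt P w ε s X)
    (h2 : DefLe P w ε (c + ε) X) : HNIoc (DefP P w ε) (c + ε) s X := by
  have e1 := h.pos_eps
  have e2 := h.eps_le
  have hint : ∀ {Y : D}, DefGt P w ε (c - ε) Y → DefLe P w ε (c + ε) Y →
      P.interval (Set.Ioo (c - η) (c + η)) Y := fun hY hY' =>
    h.interval (Slicing.gt_anti (by linarith) (h.gt_of_defGt hY)) (Slicing.le_mono (by linarith) hY'.le)
  induction X using (h.finite c).wellFounded_sub.induction generalizing s with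
  | _ X ih =>
    by_cases hX0 : IsZero X
    · exact .zero _ _ hX0
    have hub : ∀ t, DefGt P w ε t X → t ≤ c + ε := fun t ht => by
      by_contra! hlt
      exact hX0 (ht.isZero h2 hlt.le)
    have hbdd : BddAbove {t | DefGt P w ε t X} := ⟨c + ε, hub⟩
    -- This is the lowest phase of X. The truncation just above t₀ has a nonzero quotient B, for
    -- otherwise X would lie in `DefGt` beyond the supremum; B is semistable of phase t₀.
    set t₀ := sSup {t | DefGt P w ε t X} with ht₀
    have hst : s ≤ t₀ := le_csSup hbdd h1
    have htc : t₀ ≤ c + ε := csSup_le ⟨s, h1⟩ hub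
    have hlt : ∀ t < t₀, DefGt P w ε t X := fun t ht => by
      obtain ⟨t', ht', hlt⟩ := exists_lt_of_lt_csSup ⟨s, h1⟩ ht
      exact DefGt.anti ht' hlt.le
    obtain ⟨t', ht', A, B, hT, hA, hB⟩ :=
      h.exists_trunc_discrete (hc.trans hst) (h1.anti hc) h2
    have hB0 : ¬ IsZero B := fun hB0 => by
      obtain ⟨e⟩ := hT.nonempty_iso₁₂ hB0
      exact absurd (le_csSup hbdd (hA.of_iso e)) (not_le.2 ht')
    have hBP : DefP P w ε t₀ B :=
      ⟨hB, fun t ht => h.defGt_quot hT (hlt t ht) hA (by linarith)⟩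
    have hBs : DefGt P w ε s B := h.defGt_quot hT h1 hA (by linarith)
    have hst' : s < t₀ := lt_of_le_of_ne hst fun heq =>
      hB0 (hBs.isZero hB heq.ge)
    have hA1 : DefGt P w ε t₀ A := hA.anti ht'.le
    have hA2 : DefLe P w ε (c + ε) A := h.defLe_sub hT h2 hB (by linarith)
    exact .step s t₀ A X B hst' htc (ih A ⟨B, hint (hA1.anti (by linarith)) hA2,
      hint (h1.anti hc) h2, hint (hBs.anti hc) (hB.mono htc), hB0, hT⟩ (by linarith) hA1 hA2) hBP hT

/-- A bounded range of phases is covered by k windows of width 2ε, whose filtrations are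
concatenated. -/
lemma hnIoc_nat (k : ℕ) {s : ℝ} {X : D} (h1 : DefGt P w ε s X)
    (h2 : DefLe P w ε (s + 2 * ε * k) X) : HNIoc (DefP P w ε) (s + 2 * ε * k) s X := by
  have e1 := h.pos_eps
  have e2 := h.eps_le
  induction k generalizing s X with
  | zero => exact .zero _ _ (h1.isZero h2 (by simp))
  | succ k ih =>
    have hk : (0 : ℝ) ≤ 2 * ε * k := by positivity
    have e3 : s + 2 * ε * (k + 1 : ℕ) = s + 2 * ε + 2 * ε * k := by push_cast; ring
    rw [e3] at h2 ⊢
    obtain ⟨A, B, hT, hA, hB⟩ := h.exists_trunc (s + 2 * ε) X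
    have hA2 := ih hA (h.defLe_sub hT h2 hB (by linarith))
    have hB1 : DefGt P w ε s B := h.defGt_quot hT h1 hA (by linarith)
    have hB2 := h.hnIoc_window (c := s + ε) (by linarith) hB1 (hB.mono (by linarith))
    exact (hB2.mono le_rfl (by linarith : s + ε + ε ≤ s + 2 * ε)).concat hA2 (by linarith)
      (by linarith) hT

lemma exists_hn (X : D) : Nonempty (HNFiltration (DefP P w ε) X) := by
  have e1 := h.pos_eps
  obtain ⟨s, u, hsu, hs, hu⟩ := P.exists_bounds X
  obtain ⟨k, hk⟩ := exists_nat_ge ((u + ε - (s - ε)) / (2 * ε))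
  rw [div_le_iff₀ (by linarith)] at hk
  have := h.hnIoc_nat k (s := s - ε) (.of_gt (by simpa using hs))
    ((h.defLe_of_le (t := u + ε) (by simpa using hu)).mono (by linarith))
  obtain ⟨F, -⟩ := this.exists_hnFiltration
  exact ⟨F⟩

/-- The deformed slicing. -/
def slicing : Slicing D where
  P := DefP P w ε
  closedUnderIso φ := ⟨fun e hX => ⟨hX.1.of_iso e, fun s hs => (hX.2 s hs).of_iso e⟩⟩
  zero_mem φ E hE := ⟨.of_isZero hE, fun _ _ => .of_isZero hE⟩
  shift_iff φ E := by
    refine ⟨fun hE => ⟨?_, fun s hs => ?_⟩, fun hE => ⟨h.defLe_shift hE.1, fun s hs => ?_⟩⟩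
    · have := h.defLe_shift_neg hE.1
      rw [add_sub_cancel_right] at this
      exact this.of_iso (shiftShiftNeg E (1 : ℤ))
    · have := h.defGt_shift_neg (hE.2 (s + 1) (by linarith))
      rw [add_sub_cancel_right] at this
      exact this.of_iso (shiftShiftNeg E (1 : ℤ))
    · have := h.defGt_shift (hE.2 (s - 1) (by linarith))
      rwa [sub_add_cancel] at this
  hom_eq_zero φ₁ φ₂ E₁ E₂ h₁ h₂ hlt f := h₂.1 E₁ (h₁.2 φ₂ hlt) f
  exists_hn E _ := h.exists_hn E

lemma dist_slicing_le : P.dist h.slicing ≤ ENNReal.ofReal ε := by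
  refine Slicing.dist_le_of_forall_P h.pos_eps.le (fun φ E hE => ⟨?_, fun s hs => ?_⟩)
    fun φ E hE => ⟨hE.1.le, fun s hs => h.gt_of_defGt (hE.2 s hs)⟩
  · intro ψ F hψ hF
    exact h.defLe_of_le (by simpa using Slicing.le_of_P hE le_rfl) F (hF.2 _ hψ)
  · intro ψ F hψ hF
    refine hF.1.mono hψ E (.of_gt (by simpa using Slicing.gt_of_P hE hs))

/-- Objects of Q(ψ) have P-phases in (ψ - 2ε, ψ + ε], and 2ε < η/2, so halving η puts the
Q-intervals inside the finite length P-intervals. -/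
lemma isLocallyFinite_slicing (hη : η < 1 / 2) : h.slicing.IsLocallyFinite := by
  have e1 := h.pos_eps
  have e2 := h.lt_eta
  refine ⟨η / 2, by linarith, by linarith, fun φ => (h.finite φ).anti fun X hX => ?_⟩
  refine ExtClosure.le_of_le (fun Y hY => ?_) (fun A B C => ExtClosure.of_tri) hX
  obtain ⟨ψ, hψ, hY⟩ := hY
  exact Slicing.interval_of_gt_le (a := ψ - 2 * ε) (b := ψ + ε)
    (fun x hx => Set.mem_Ioo.2
      ⟨by linarith [hx.1, hψ.1], by linarith [hx.2, hψ.2]⟩)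
    (by linarith) (h.gt_of_defP hY) hY.1.le

end IsDeformation

end

/-! ### Classes in filtered lattices -/

section Lattice

variable {Γ : Type*} [AddCommGroup Γ] {N : ℕ}

namespace LatticeFiltration

variable (F : LatticeFiltration Γ N)

/-- The level of `v` together with its class at this level. -/
noncomputable def sig (v : Γ) : Σ i, F.gr i := ⟨F.level v, F.symb v⟩

lemma sig_eq_of_level {v : Γ} {i : Fin (N + 1)} (h : F.level v = i) (hv : v ∈ F.sub i.succ) :
    F.sig v = ⟨i, Submodule.Quotient.mk ⟨v, hv⟩⟩ := by
  subst h
  rfl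

lemma sub_le {i j : Fin (N + 1)} (h : i < j) : F.sub i.succ ≤ F.sub j.castSucc :=
  F.strictMono.monotone (Fin.succ_le_castSucc_iff.2 h)

lemma mk_eq_zero {i : Fin (N + 1)} {v : Γ} (hv : v ∈ F.sub i.succ) :
    (Submodule.Quotient.mk ⟨v, hv⟩ : F.gr i) = 0 ↔ v ∈ F.sub i.castSucc := by
  rw [Submodule.Quotient.mk_eq_zero]
  rfl

lemma sig_eq {v : Γ} {i : Fin (N + 1)} (hv : v ∈ F.sub i.succ)
    (hne : (Submodule.Quotient.mk ⟨v, hv⟩ : F.gr i) ≠ 0) :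
    F.sig v = ⟨i, Submodule.Quotient.mk ⟨v, hv⟩⟩ := by
  refine F.sig_eq_of_level ?_ hv
  classical
  refine (Fin.find_eq_iff (F.exists_mem v)).2 ⟨hv, fun j hj hvj => hne ?_⟩
  exact (F.mk_eq_zero hv).2 (F.sub_le hj hvj)

lemma level_neg (v : Γ) : F.level (-v) = F.level v := by
  classical
  refine (Fin.find_eq_iff (F.exists_mem (-v))).2 ⟨neg_mem (F.mem_level v), fun j hj hvj => ?_⟩
  exact Fin.find_min (F.exists_mem v) hj (neg_mem_iff.1 hvj)

lemma sig_neg (v : Γ) : F.sig (-v) = ⟨F.level v, -F.symb v⟩ :=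
  F.sig_eq_of_level (F.level_neg v) (neg_mem (F.mem_level v))

lemma sig_add_of_lt {x z : Γ} (hz : F.symb z ≠ 0) (h : F.level x < F.level z) :
    F.sig (x + z) = F.sig z := by
  have hx : x ∈ F.sub (F.level z).castSucc := F.sub_le h (F.mem_level x)
  have hx' : x ∈ F.sub (F.level z).succ :=
    F.strictMono.monotone (Fin.castSucc_lt_succ).le hx
  have e : (Submodule.Quotient.mk ⟨x + z, add_mem hx' (F.mem_level z)⟩ : F.gr (F.level z)) =
      F.symb z := by
    refine (Submodule.Quotient.eq _).2 ?_
    change x + z - z ∈ F.sub (F.level z).castSucc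
    simpa using hx
  rw [F.sig_eq (add_mem hx' (F.mem_level z)) (by rwa [e]), e]
  rfl

/-- The higher level wins; at equal levels the classes add, unless they cancel and the level drops
uncontrollably. -/
lemma sig_add {x z : Γ} (hx : F.symb x ≠ 0) (hz : F.symb z ≠ 0) :
    F.sig (x + z) = F.sig x ∨ F.sig (x + z) = F.sig z ∨
      ∃ i a b, F.sig x = ⟨i, a⟩ ∧ F.sig z = ⟨i, b⟩ ∧ (a + b ≠ 0 → F.sig (x + z) = ⟨i, a + b⟩) := by
  rcases lt_trichotomy (F.level x) (F.level z) with h | h | h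
  · exact .inr (.inl (F.sig_add_of_lt hz h))
  · have hz' : z ∈ F.sub (F.level x).succ := h ▸ F.mem_level z
    exact .inr (.inr ⟨F.level x, F.symb x, Submodule.Quotient.mk ⟨z, hz'⟩, rfl,
      F.sig_eq_of_level h.symm hz', fun hne => F.sig_eq (add_mem (F.mem_level x) hz') hne⟩)
  · rw [add_comm x z]
    exact .inl (F.sig_add_of_lt hx h)

end LatticeFiltration

/-- Linear forms on a finite dimensional space are bounded for every norm; p is turned into a local
norm instance. -/
lemma exists_abs_le_seminorm {V : Type*} [AddCommGroup V] [Module ℝ V] [FiniteDimensional ℝ V]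
    (p : Seminorm ℝ V) (hp : ∀ x, p x = 0 → x = 0) (f : V →ₗ[ℝ] ℝ) :
    ∃ K : ℝ, 0 ≤ K ∧ ∀ x, |f x| ≤ K * p x := by
  let _ : NormedAddCommGroup V := AddGroupNorm.toNormedAddCommGroup
    { p.toAddGroupSeminorm with eq_zero_of_map_eq_zero' := hp }
  let _ : NormedSpace ℝ V := ⟨fun a x => (map_smul_eq_mul p a x).le⟩
  exact ⟨‖LinearMap.toContinuousLinearMap f‖, norm_nonneg _,
    fun x => (LinearMap.toContinuousLinearMap f).le_opNorm x⟩

lemma exists_norm_apply_le {H : Type*} [AddCommGroup H] [Module.Free ℤ H] [Module.Finite ℤ H]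
    (p : Seminorm ℝ (ℝ ⊗[ℤ] H)) (hp : ∀ x, p x = 0 → x = 0) :
    ∃ K : ℝ, 0 ≤ K ∧ ∀ (u : H →ₗ[ℤ] ℂ) (x : H), ‖u x‖ ≤ K * ‖u‖ * p (1 ⊗ₜ[ℤ] x) := by
  let b := Module.Free.chooseBasis ℤ H
  choose K hK0 hK using fun i => exists_abs_le_seminorm p hp ((b.baseChange ℝ).coord i)
  refine ⟨∑ i, K i, Finset.sum_nonneg fun i _ => hK0 i, fun u x => ?_⟩
  have hu : ∀ i, ‖u (b i)‖ ≤ ‖u‖ := fun i => norm_le_pi_norm ((b.constr ℂ (M' := ℂ)).symm u) i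
  have hr : ∀ i, |(b.repr x i : ℝ)| ≤ K i * p (1 ⊗ₜ[ℤ] x) := fun i => by
    have := hK i (1 ⊗ₜ[ℤ] x)
    rwa [Module.Basis.coord_apply, Module.Basis.baseChange_repr_tmul, zsmul_one] at this
  calc ‖u x‖ = ‖∑ i, b.repr x i • u (b i)‖ := by
        conv_lhs => rw [← b.sum_repr x]
        simp only [map_sum, map_smul]
    _ ≤ ∑ i, ‖b.repr x i • u (b i)‖ := norm_sum_le _ _
    _ ≤ ∑ i, K i * p (1 ⊗ₜ[ℤ] x) * ‖u‖ := by
        refine Finset.sum_le_sum fun i _ => ?_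
        rw [zsmul_eq_mul, norm_mul]
        have : ‖((b.repr x i : ℤ) : ℂ)‖ = |(b.repr x i : ℝ)| := by
          rw [← Complex.ofReal_intCast, Complex.norm_real, Real.norm_eq_abs]
        rw [this]
        exact mul_le_mul (hr i) (hu i) (norm_nonneg _) (mul_nonneg (hK0 i) (apply_nonneg p _))
    _ = (∑ i, K i) * ‖u‖ * p (1 ⊗ₜ[ℤ] x) := by
        rw [← Finset.sum_mul, ← Finset.sum_mul]; ring

/-- There are finitely many levels, so one constant serves all. With the support property this
controls W - Z on semistable objects. -/
lemma GrNorms.exists_bound [Module.Finite ℤ Γ] {F : LatticeFiltration Γ N} (ν : GrNorms F) :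
    ∃ K : ℝ, 0 < K ∧ ∀ (Z W : Charges F) (v : Γ),
      ‖W.eval v - Z.eval v‖ ≤ K * ‖W - Z‖ * ν.eval v := by
  choose K hK0 hK using fun i => exists_norm_apply_le (ν.nrm i) (ν.eq_zero i)
  have hs : 0 ≤ ∑ i, K i := Finset.sum_nonneg fun i _ => hK0 i
  refine ⟨1 + ∑ i, K i, by linarith, fun Z W v => ?_⟩
  refine (hK (F.level v) (W (F.level v) - Z (F.level v)) (F.symb v)).trans ?_
  have h1 : K (F.level v) ≤ 1 + ∑ i, K i := by
    have := Finset.single_le_sum (fun i _ => hK0 i) (Finset.mem_univ (F.level v))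
    linarith
  have h2 : ‖W (F.level v) - Z (F.level v)‖ ≤ ‖W - Z‖ := norm_le_pi_norm (W - Z) (F.level v)
  exact mul_le_mul_of_nonneg_right (mul_le_mul h1 h2 (norm_nonneg _) (by linarith))
    (apply_nonneg _ _)

end Lattice

/-! ### Central charges as functions on objects -/

section

variable {D : Type*} [Category D] [Preadditive D] [HasZeroObject D] [HasShift D ℤ]
  [∀ n : ℤ, (shiftFunctor D n).Additive] [Pretriangulated D]

lemma K.cls_tri {A B C : D} (h : Tri A B C) : K.cls B = K.cls A + K.cls C := by
  obtain ⟨f, g, k, h⟩ := h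
  have : K.cls B - K.cls A - K.cls C = 0 := by
    refine (QuotientAddGroup.eq_zero_iff _).2 (AddSubgroup.subset_closure ⟨_, h, rfl⟩)
  rw [sub_sub, sub_eq_zero] at this
  exact this

lemma K.cls_zero {X : D} (h : IsZero X) : K.cls X = 0 := by
  have := K.cls_tri (tri_zero_left h X)
  simpa using this

lemma K.cls_iso {X Y : D} (e : X ≅ Y) : K.cls X = K.cls Y := by
  obtain ⟨Z, hZ⟩ := (inferInstance : HasZeroObject D).zero
  have := K.cls_tri ((tri_zero_left hZ X).congr (Iso.refl _) (Iso.refl _) e)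
  rwa [K.cls_zero hZ, zero_add] at this

lemma K.cls_shift (X : D) : K.cls (X⟦(1 : ℤ)⟧) = -K.cls X := by
  obtain ⟨Z, hZ⟩ := (inferInstance : HasZeroObject D).zero
  have := K.cls_tri (tri_zero_right hZ X).rotate
  rw [← add_eq_zero_iff_eq_neg', ← this, K.cls_zero hZ]

variable {Γ : Type*} [AddCommGroup Γ] {N : ℕ} (cl : K D →+ Γ) {F : LatticeFiltration Γ N}

/-- The charge of an object. -/
noncomputable def objCharge (W : Charges F) (E : D) : ℂ := W.eval (cl (K.cls E))

/-- The norm of the class of an object. -/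
noncomputable def objNorm (ν : GrNorms F) (E : D) : ℝ := ν.eval (cl (K.cls E))

lemma objCharge_iso (W : Charges F) {X Y : D} (e : X ≅ Y) : objCharge cl W X = objCharge cl W Y := by
  rw [objCharge, K.cls_iso e, objCharge]

lemma objNorm_iso (ν : GrNorms F) {X Y : D} (e : X ≅ Y) : objNorm cl ν X = objNorm cl ν Y := by
  rw [objNorm, K.cls_iso e, objNorm]

/-- Charge and norm factor through `sig`, so `sig_add` applies. They are treated together because
the support property needs the same alternative for both. -/
lemma objCharge_objNorm_tri (W : Charges F) (ν : GrNorms F) {A B C : D} (h : Tri A B C) {s : ℝ}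
    (hA : 0 < height s (objCharge cl W A)) (hC : 0 < height s (objCharge cl W C)) :
    (objCharge cl W B = objCharge cl W A ∧ objNorm cl ν B = objNorm cl ν A) ∨
    (objCharge cl W B = objCharge cl W C ∧ objNorm cl ν B = objNorm cl ν C) ∨
    (objCharge cl W B = objCharge cl W A + objCharge cl W C ∧
      objNorm cl ν B ≤ objNorm cl ν A + objNorm cl ν C) := by
  let w : (Σ i, F.gr i) → ℂ := fun x => W x.1 x.2
  let n : (Σ i, F.gr i) → ℝ := fun x => ν.nrm x.1 (1 ⊗ₜ[ℤ] x.2)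
  have hw : ∀ E : D, objCharge cl W E = w (F.sig (cl (K.cls E))) := fun _ => rfl
  have hn : ∀ E : D, objNorm cl ν E = n (F.sig (cl (K.cls E))) := fun _ => rfl
  have hs : ∀ E : D, 0 < height s (objCharge cl W E) → F.symb (cl (K.cls E)) ≠ 0 := by
    intro E hE h0
    have : objCharge cl W E = 0 := by
      change W _ (F.symb (cl (K.cls E))) = 0
      rw [h0, map_zero]
    rw [this, height_zero] at hE
    exact lt_irrefl _ hE
  have e := K.cls_tri h
  rcases F.sig_add (hs A hA) (hs C hC) with h | h | ⟨i, a, b, h1, h2, h3⟩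
  · left
    rw [hw B, hn B, e, map_add, h]
    exact ⟨rfl, rfl⟩
  · right; left
    rw [hw B, hn B, e, map_add, h]
    exact ⟨rfl, rfl⟩
  · right; right
    rw [hw, h1] at hA
    rw [hw, h2] at hC
    have hab : w ⟨i, a + b⟩ = w ⟨i, a⟩ + w ⟨i, b⟩ := map_add (W i) a b
    -- Two charges in one open half plane cannot cancel.
    have hne : a + b ≠ 0 := fun h0 => by
      have : 0 < height s (w ⟨i, a + b⟩) := by rw [hab, height_add]; exact add_pos hA hC
      rw [show w ⟨i, a + b⟩ = 0 by change W i (a + b) = 0; rw [h0, map_zero], height_zero] at this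
      exact lt_irrefl _ this
    rw [hw B, hn B, e, map_add, h3 hne, hw A, hn A, h1, hw C, hn C, h2]
    refine ⟨hab, ?_⟩
    change ν.nrm i (1 ⊗ₜ[ℤ] (a + b)) ≤ ν.nrm i (1 ⊗ₜ[ℤ] a) + ν.nrm i (1 ⊗ₜ[ℤ] b)
    rw [TensorProduct.tmul_add]
    exact map_add_le_add _ _ _

lemma isWeakCharge_objCharge (ν : GrNorms F) (W : Charges F) : IsWeakCharge (objCharge cl W) where
  iso := objCharge_iso cl W
  shift X := by
    have : F.sig (cl (K.cls (X⟦(1 : ℤ)⟧))) =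
        ⟨F.level (cl (K.cls X)), -F.symb (cl (K.cls X))⟩ := by
      rw [K.cls_shift, map_neg]
      exact F.sig_neg _
    change W (F.sig (cl (K.cls (X⟦(1 : ℤ)⟧)))).1 (F.sig (cl (K.cls (X⟦(1 : ℤ)⟧)))).2 = _
    rw [this]
    exact map_neg _ _
  tri h s hA hC := (objCharge_objNorm_tri cl W ν h hA hC).imp And.left (Or.imp And.left And.left)

/-! ### Deformation of weak stability conditions -/

lemma sin_le_sin_of_mem {ε x : ℝ} (h0 : 0 < ε) (h1 : ε ≤ x) (h2 : x ≤ 1 - ε) :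
    Real.sin (Real.pi * ε) ≤ Real.sin (Real.pi * x) := by
  have hpi := Real.pi_pos
  rcases le_total x (1 / 2) with h | h
  · exact Real.sin_le_sin_of_le_of_le_pi_div_two (by nlinarith) (by nlinarith) (by nlinarith)
  · rw [← Real.sin_pi_sub (Real.pi * x)]
    exact Real.sin_le_sin_of_le_of_le_pi_div_two (by nlinarith) (by nlinarith) (by nlinarith)

variable {cl} {P : Slicing D} {ν : GrNorms F} {Z W : Charges F}

/-- Charges of semistable objects vary little in comparison with the norm. -/
lemma IsWeakStability.height_ge [Module.Finite ℤ Γ] (hσ : IsWeakStability cl F ν P Z) {C K ε : ℝ}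
    (hC : ∀ (φ : ℝ) (E : D), P.P φ E → ¬ IsZero E → objNorm cl ν E ≤ C * ‖objCharge cl Z E‖)
    (hK : ∀ v, ‖W.eval v - Z.eval v‖ ≤ K * ν.eval v) (hK0 : 0 ≤ K) (hε : 0 < ε)
    (hKC : K * C ≤ Real.sin (Real.pi * ε) / 2) {φ t : ℝ} {E : D} (hE : P.P φ E)
    (hE0 : ¬ IsZero E) (h1 : t + ε ≤ φ) (h2 : φ ≤ t + 1 - ε) :
    0 < ‖objCharge cl Z E‖ ∧
      Real.sin (Real.pi * ε) / 2 * ‖objCharge cl Z E‖ ≤ height t (objCharge cl W E) := by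
  obtain ⟨r, hr, e⟩ := hσ.phase φ E hE hE0
  have hn : ‖objCharge cl Z E‖ = r := by
    rw [objCharge, e, norm_mul, Complex.norm_real, Real.norm_of_nonneg hr.le,
      show Complex.I * (Real.pi : ℂ) * (φ : ℂ) = ((Real.pi * φ : ℝ) : ℂ) * Complex.I by
        push_cast; ring, Complex.norm_exp_ofReal_mul_I, mul_one]
  refine ⟨hn ▸ hr, ?_⟩
  have h3 : ‖objCharge cl W E - objCharge cl Z E‖ ≤ Real.sin (Real.pi * ε) / 2 * r := by
    refine (hK _).trans ((mul_le_mul_of_nonneg_left (hC φ E hE hE0) hK0).trans ?_)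
    rw [hn, ← mul_assoc]
    exact mul_le_mul_of_nonneg_right hKC hr.le
  have h4 := (abs_le.1 ((abs_height_le t _).trans h3)).1
  have h5 : objCharge cl W E = objCharge cl Z E + (objCharge cl W E - objCharge cl Z E) := by ring
  have h6 : height t (objCharge cl Z E) = r * Real.sin (Real.pi * (φ - t)) := by
    rw [objCharge, e, height_exp]
  have h7 := sin_le_sin_of_mem hε (x := φ - t) (by linarith) (by linarith)
  rw [h5, height_add, h6, hn]
  nlinarith [mul_le_mul_of_nonneg_left h7 hr.le]

variable [IsTriangulated D]

/-- Every small deformation of the central charge lifts to a deformation of the weak stability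
condition. -/
theorem IsWeakStability.exists_deformation [Module.Finite ℤ Γ] (hσ : IsWeakStability cl F ν P Z)
    (hP : P.IsLocallyFinite) {ε₀ : ℝ} (hε₀ : 0 < ε₀) :
    ∃ δ > 0, ∀ W : Charges F, ‖W - Z‖ < δ → ∃ Q : Slicing D, Q.IsLocallyFinite ∧
      IsWeakStability cl F ν Q W ∧ P.dist Q ≤ ENNReal.ofReal ε₀ := by
  obtain ⟨η, hη0, hη, hfin⟩ := hP
  obtain ⟨C, hC0, hC⟩ := hσ.support
  obtain ⟨K, hK0, hK⟩ := ν.exists_bound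
  -- The three bounds give the required distance, the inequality 4ε < η, and the room used in the
  -- phase estimates.
  set ε := min ε₀ (min (η / 8) (1 / 16)) with hε
  have hε0 : 0 < ε := lt_min hε₀ (lt_min (by linarith) (by norm_num))
  have hε1 : ε ≤ η / 8 := (min_le_right _ _).trans (min_le_left _ _)
  have hε2 : ε ≤ 1 / 16 := (min_le_right _ _).trans (min_le_right _ _)
  have hsin : 0 < Real.sin (Real.pi * ε) / 2 :=
    half_pos (Real.sin_pos_of_pos_of_lt_pi (by positivity) (by nlinarith [Real.pi_pos]))
  -- At angular distance at least πε from the line, Z(E) has height at least sin(πε) ‖Z(E)‖; this δ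
  -- lets W lose at most half of it.
  refine ⟨Real.sin (Real.pi * ε) / 2 / (K * C), by positivity, fun W hW => ?_⟩
  have hKC : K * ‖W - Z‖ * C ≤ Real.sin (Real.pi * ε) / 2 := by
    rw [lt_div_iff₀ (by positivity)] at hW
    nlinarith
  have key : ∀ {φ t : ℝ} {E : D}, P.P φ E → ¬ IsZero E → t + ε ≤ φ → φ ≤ t + 1 - ε →
      0 < ‖objCharge cl Z E‖ ∧
      Real.sin (Real.pi * ε) / 2 * ‖objCharge cl Z E‖ ≤ height t (objCharge cl W E) :=
    fun hE hE0 h1 h2 => hσ.height_ge hC (hK Z W) (by positivity) hε0 hKC hE hE0 h1 h2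
  have hdef : IsDeformation P (objCharge cl W) ε η :=
    { charge := isWeakCharge_objCharge cl ν W
      pos_eps := hε0
      eps_le := hε2
      lt_eta := by linarith
      pos := fun hE hE0 h1 h2 => by
        obtain ⟨h3, h4⟩ := key hE hE0 h1 h2
        exact (mul_pos hsin h3).trans_le h4
      finite := hfin }
  refine ⟨hdef.slicing, hdef.isLocallyFinite_slicing hη,
    ⟨fun φ E hE hE0 => hdef.charge_defP hE hE0, C / (Real.sin (Real.pi * ε) / 2), by positivity,
      fun φ E hE hE0 => ?_⟩,
    hdef.dist_slicing_le.trans (ENNReal.ofReal_le_ofReal (min_le_left _ _))⟩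
  -- Support for Q: decompose E with respect to P. All factors lie in the half plane at φ - 1/2,
  -- where the norm is bounded by a multiple of the height, a bound that survives extensions.
  have hE' := Slicing.hnIoc (hdef.gt_of_defP hE) hE.1.le
  have h1 := hE'.induction_ne hE0 (p := fun X => 0 < height (φ - 1 / 2) (objCharge cl W X) ∧
    objNorm cl ν X ≤ C / (Real.sin (Real.pi * ε) / 2) * height (φ - 1 / 2) (objCharge cl W X))
    (fun X Y e hX => by rwa [← objCharge_iso cl W e, ← objNorm_iso cl ν e])
    (fun ψ X h1 h2 hX hX0 => by
      obtain ⟨h3, h4⟩ := key (t := φ - 1 / 2) hX hX0 (by linarith) (by linarith)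
      refine ⟨(mul_pos hsin h3).trans_le h4, (hC ψ X hX hX0).trans ?_⟩
      rw [div_mul_eq_mul_div, le_div_iff₀ hsin, mul_assoc, mul_comm ‖_‖]
      exact mul_le_mul_of_nonneg_left h4 hC0.le)
    (fun A B C' hT hA hC' => by
      rcases objCharge_objNorm_tri cl W ν hT hA.1 hC'.1 with ⟨e1, e2⟩ | ⟨e1, e2⟩ | ⟨e1, e2⟩
      · rwa [e1, e2]
      · rwa [e1, e2]
      · rw [e1, height_add, mul_add]
        exact ⟨add_pos hA.1 hC'.1, e2.trans (add_le_add hA.2 hC'.2)⟩)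
  exact h1.2.trans (mul_le_mul_of_nonneg_left ((le_abs_self _).trans (abs_height_le _ _))
    (by positivity))

end

/-! ### Topology of local homeomorphisms -/

section Topology

open Set Topology TopologicalSpace

/-- The charted space structure induced by a local homeomorphism to the model space. -/
@[reducible] noncomputable def chartedSpaceOfIsLocalHomeomorph {M H : Type*} [TopologicalSpace M]
    [TopologicalSpace H] {f : M → H} (hf : IsLocalHomeomorph f) : ChartedSpace H M where
  atlas := {e | f = e}
  chartAt x := (hf x).choose
  mem_chart_source x := (hf x).choose_spec.1
  chart_mem_atlas x := (hf x).choose_spec.2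

/-- All charts are restrictions of f, so changes of charts are identities and f reads as the
identity in a chart. -/
lemma exists_isManifold_isLocalDiffeomorph {M H : Type*} [TopologicalSpace M]
    [NormedAddCommGroup H] [NormedSpace ℂ H] {f : M → H} (hf : IsLocalHomeomorph f) :
    ∃ _ : ChartedSpace H M, IsManifold 𝓘(ℂ, H) ω M ∧ IsLocalDiffeomorph 𝓘(ℂ, H) 𝓘(ℂ, H) ω f := by
  let _ := chartedSpaceOfIsLocalHomeomorph hf
  have hM : IsManifold 𝓘(ℂ, H) ω M := by
    refine isManifold_of_contDiffOn _ _ _ fun e e' he he' => ?_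
    refine contDiffOn_id.congr fun x hx => ?_
    have hx' : x ∈ (e.symm ≫ₕ e').source := hx.1
    rw [OpenPartialHomeomorph.trans_source] at hx'
    have h1 : f = e := he
    have h2 : f = e' := he'
    change e' (e.symm x) = x
    rw [← h2, h1]
    exact e.right_inv hx'.1
  refine ⟨inferInstance, hM, fun x => ?_⟩
  refine ⟨⟨(chartAt H x).toPartialEquiv, (chartAt H x).open_source, (chartAt H x).open_target,
    contMDiffOn_chart, contMDiffOn_chart_symm⟩, mem_chart_source H x, fun y _ => ?_⟩
  exact congrFun (hf x).choose_spec.2 y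

/-- A connected paracompact space which is locally separable is separable. -/
lemma separableSpace_of_locally {X : Type*} [TopologicalSpace X] [ParacompactSpace X]
    [PreconnectedSpace X] (h : ∀ x : X, ∃ U : Set X, IsOpen U ∧ x ∈ U ∧ IsSeparable U) :
    SeparableSpace X := by
  rcases isEmpty_or_nonempty X with hX | ⟨⟨x₀⟩⟩
  · infer_instance
  choose U hUo hxU hUs using h
  obtain ⟨V, hVo, hVc, hVf, hVU⟩ := precise_refinement U hUo
    (iUnion_eq_univ_iff.2 fun x => ⟨x, hxU x⟩)
  have hVs : ∀ i, IsSeparable (V i) := fun i => (hUs i).mono (hVU i)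
  -- Each V j meeting V i contains a point of a countable set whose closure contains V i, and each
  -- such point lies in finitely many V j.
  have hcount : ∀ i, {j | (V j ∩ V i).Nonempty}.Countable := by
    intro i
    obtain ⟨c, hc, hVc⟩ := hVs i
    refine (hc.biUnion fun x _ => (hVf.point_finite x).countable).mono ?_
    rintro j ⟨y, hyj, hyi⟩
    obtain ⟨z, hz, hzc⟩ := mem_closure_iff.1 (hVc hyi) (V j) (hVo j) hyj
    exact mem_biUnion hzc hz
  obtain ⟨i₀, hi₀⟩ := iUnion_eq_univ_iff.1 hVc x₀
  -- Indices reachable from i₀ by n successive overlaps; the union of all reachable V i is clopen,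
  -- hence everything.
  let J : ℕ → Set X := fun n => n.rec {i₀} fun _ S => ⋃ i ∈ S, {j | (V j ∩ V i).Nonempty}
  have hJc : ∀ n, (J n).Countable := by
    intro n
    induction n with
    | zero => exact countable_singleton i₀
    | succ n ih => exact ih.biUnion fun i _ => hcount i
  have hJ : (⋃ n, J n).Countable := countable_iUnion hJc
  let S : Set X := ⋃ i ∈ ⋃ n, J n, V i
  have hSo : IsOpen S := isOpen_biUnion fun i _ => hVo i
  have hSc : IsClosed S := by
    rw [← isOpen_compl_iff]
    have : Sᶜ = ⋃ i ∈ (⋃ n, J n)ᶜ, V i := by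
      ext x
      refine ⟨fun hx => ?_, fun hx hxS => ?_⟩
      · obtain ⟨i, hi⟩ := iUnion_eq_univ_iff.1 hVc x
        exact mem_biUnion (fun hiJ => hx (mem_biUnion hiJ hi)) hi
      · obtain ⟨j, hj, hxj⟩ := mem_iUnion₂.1 hx
        obtain ⟨i, hi, hxi⟩ := mem_iUnion₂.1 hxS
        obtain ⟨n, hn⟩ := mem_iUnion.1 hi
        exact hj (mem_iUnion.2 ⟨n + 1, mem_biUnion hn ⟨x, hxj, hxi⟩⟩)
    rw [this]
    exact isOpen_biUnion fun i _ => hVo i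
  have hS : S = univ := IsClopen.eq_univ ⟨hSc, hSo⟩
    ⟨x₀, mem_biUnion (mem_iUnion.2 ⟨0, rfl⟩) hi₀⟩
  rw [← isSeparable_univ_iff, ← hS]
  have := hJ.to_subtype
  exact (isSeparable_iUnion.2 fun i : ⋃ n, J n => hVs i).mono (biUnion_eq_iUnion _ _).le

lemma secondCountableTopology_of_isLocalHomeomorph {X H : Type*} [PseudoEMetricSpace X]
    [PreconnectedSpace X] [TopologicalSpace H] [SecondCountableTopology H] {f : X → H}
    (hf : IsLocalHomeomorph f) : SecondCountableTopology X := by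
  have : SeparableSpace X := by
    refine separableSpace_of_locally fun x => ?_
    obtain ⟨e, hx, -⟩ := hf x
    refine ⟨e.source, e.open_source, hx, ?_⟩
    have h1 : SecondCountableTopology e.source :=
      e.toHomeomorphSourceTarget.secondCountableTopology
    have := isSeparable_range (continuous_subtype_val (p := (· ∈ e.source)))
    rwa [Subtype.range_coe] at this
  exact UniformSpace.secondCountable_of_separable X

end Topology

lemma locallyConnectedSpace_of_normedSpace (H : Type*) [NormedAddCommGroup H] [NormedSpace ℂ H] :
    LocallyConnectedSpace H := inferInstance

instance secondCountableTopology_dual (H : Type*) [AddCommGroup H] [Module.Free ℤ H]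
    [Module.Finite ℤ H] : SecondCountableTopology (H →ₗ[ℤ] ℂ) :=
  (Topology.IsInducing.mk rfl : Topology.IsInducing
    ((Module.Free.chooseBasis ℤ H).constr ℂ (M' := ℂ)).symm).secondCountableTopology

/-! ### The space of weak stability conditions -/

section

variable {D : Type*} [Category D] [Preadditive D] [HasZeroObject D] [HasShift D ℤ]
  [∀ n : ℤ, (shiftFunctor D n).Additive] [Pretriangulated D]

instance : T2Space (Slice D) := by
  have : T0Space (Slice D) := ⟨fun P Q h =>
    Subtype.ext (Slicing.eq_of_dist_eq_zero (EMetric.inseparable_iff.1 h))⟩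
  infer_instance

variable {Γ : Type*} [AddCommGroup Γ] [Module.Finite ℤ Γ] {N : ℕ}
  (cl : K D →+ Γ) (F : LatticeFiltration Γ N) (ν : GrNorms F)

namespace Stab

instance : T2Space (Stab cl F ν) :=
  inferInstanceAs (T2Space {σ : Slice D × Charges F // IsWeakStability cl F ν σ.1.1 σ.2})

lemma continuous_charge : Continuous (Stab.charge cl F ν) :=
  continuous_snd.comp continuous_subtype_val

variable [IsTriangulated D]

lemma isOpenMap_charge : IsOpenMap (Stab.charge cl F ν) := by
  refine isOpenMap_iff_nhds_le.2 fun σ S hS => ?_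
  have hS' : Stab.charge cl F ν ⁻¹' S ∈ nhds σ := hS
  obtain ⟨ε, hε, hεS⟩ := (EMetric.mem_nhds_iff (α := Stab cl F ν)).1 hS'
  -- The radius ε may be infinite, so a finite r below it is used for the deformation.
  obtain ⟨r, hr0, hrε⟩ := ENNReal.lt_iff_exists_nnreal_btwn.1 hε
  have hr : (0 : ℝ) < r := by exact_mod_cast hr0
  obtain ⟨δ, hδ, hW⟩ := σ.2.exists_deformation σ.1.1.2 hr
  refine (Metric.mem_nhds_iff (α := Charges F)).2 ⟨min δ r, lt_min hδ hr, fun W hWball => ?_⟩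
  have hd : dist W σ.1.2 = ‖W - σ.1.2‖ := @dist_eq_norm (Charges F) _ W σ.1.2
  obtain ⟨h0, h0'⟩ := lt_min_iff.1 (Metric.mem_ball.1 hWball)
  obtain ⟨Q, hQ, hQW, hdist⟩ := hW W (hd ▸ h0)
  let Q' : Slice D := ⟨Q, hQ⟩
  let τ : Stab cl F ν := ⟨(Q', W), hQW⟩
  refine hεS (show τ ∈ _ from ?_)
  have h1 : edist Q' σ.1.1 ≤ r := by
    rw [edist_comm]
    exact hdist.trans ENNReal.ofReal_coe_nnreal.le
  have h2 : edist W σ.1.2 ≤ r :=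
    (edist_dist W σ.1.2).trans_le
      ((ENNReal.ofReal_le_ofReal h0'.le).trans ENNReal.ofReal_coe_nnreal.le)
  exact (max_le h1 h2).trans_lt hrε

/-- The forgetful map to the space of central charges is a local homeomorphism. -/
theorem isLocalHomeomorph_charge : IsLocalHomeomorph (Stab.charge cl F ν) := by
  refine isLocalHomeomorph_iff_isOpenEmbedding_restrict.2 fun σ => ?_
  have h8 : 0 < ENNReal.ofReal (1 / 8) := by simp
  -- Two points of a ball of radius 1/8 have slicings at distance at most 1/4, the range of
  -- `HasCharge.unique`.
  refine ⟨Metric.eball σ (ENNReal.ofReal (1 / 8)), Metric.eball_mem_nhds σ h8,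
    .of_continuous_injective_isOpenMap ((continuous_charge cl F ν).comp continuous_subtype_val) ?_
      ((isOpenMap_charge cl F ν).domRestrict Metric.isOpen_eball)⟩
  rintro ⟨τ, hτ⟩ ⟨τ', hτ'⟩ (heq : τ.1.2 = τ'.1.2)
  have h1 : edist τ.1.1 σ.1.1 ≤ ENNReal.ofReal (1 / 8) :=
    (le_max_left _ _).trans (Metric.mem_eball.1 hτ).le
  have h2 : edist τ'.1.1 σ.1.1 ≤ ENNReal.ofReal (1 / 8) :=
    (le_max_left _ _).trans (Metric.mem_eball.1 hτ').le
  have h3 : τ.1.1.1.dist τ'.1.1.1 ≤ ENNReal.ofReal (1 / 4) := by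
    refine (edist_triangle_right τ.1.1 τ'.1.1 σ.1.1).trans ((add_le_add h1 h2).trans ?_)
    rw [← ENNReal.ofReal_add (by norm_num) (by norm_num)]
    norm_num
  have hP : τ.1.1.1.HasCharge (objCharge cl τ.1.2) := fun φ E hE hE0 => τ.2.phase φ E hE hE0
  have hP' : τ'.1.1.1.HasCharge (objCharge cl τ.1.2) := fun φ E hE hE0 => by
    rw [heq]
    exact τ'.2.phase φ E hE hE0
  have h4 : τ.1.1 = τ'.1.1 :=
    Subtype.ext (hP.unique (isWeakCharge_objCharge cl ν τ.1.2) hP' h3)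
  exact Subtype.ext (Subtype.ext (Prod.ext h4 heq))

end Stab

end

end WeakStab

theorem theorem2p10
    {D : Type*} [Category D] [Preadditive D] [HasZeroObject D] [HasShift D ℤ]
    [∀ n : ℤ, (shiftFunctor D n).Additive] [Pretriangulated D] [IsTriangulated D]
    {Γ : Type*} [AddCommGroup Γ] [Module.Free ℤ Γ] [Module.Finite ℤ Γ] {N : ℕ}
    (cl : WeakStab.K D →+ Γ) (F : WeakStab.LatticeFiltration Γ N) (ν : WeakStab.GrNorms F) :
    IsLocalHomeomorph (WeakStab.Stab.charge cl F ν) ∧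
    ∀ σ : WeakStab.Stab cl F ν,
      T2Space ↥(connectedComponent σ) ∧
      SecondCountableTopology ↥(connectedComponent σ) ∧
      ∃ _ : ChartedSpace (WeakStab.Charges F) ↥(connectedComponent σ),
        IsManifold 𝓘(ℂ, WeakStab.Charges F) ω ↥(connectedComponent σ) ∧
        IsLocalDiffeomorph 𝓘(ℂ, WeakStab.Charges F) 𝓘(ℂ, WeakStab.Charges F) ω
          (fun τ : ↥(connectedComponent σ) => WeakStab.Stab.charge cl F ν τ.1) := by
  have h := WeakStab.Stab.isLocalHomeomorph_charge cl F ν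
  refine ⟨h, fun σ => ?_⟩
  have hlc : LocallyConnectedSpace (WeakStab.Stab cl F ν) :=
    let _ := WeakStab.chartedSpaceOfIsLocalHomeomorph h
    have := WeakStab.locallyConnectedSpace_of_normedSpace (WeakStab.Charges F)
    ChartedSpace.locallyConnectedSpace (WeakStab.Charges F) _
  have hC : IsLocalHomeomorph
      (fun τ : ↥(connectedComponent σ) => WeakStab.Stab.charge cl F ν τ.1) :=
    h.comp isOpen_connectedComponent.isOpenEmbedding_subtypeVal.isLocalHomeomorph
  have hconn : PreconnectedSpace ↥(connectedComponent σ) :=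
    Subtype.preconnectedSpace isPreconnected_connectedComponent
  exact ⟨(Topology.IsEmbedding.subtypeVal (p := (· ∈ connectedComponent σ))).t2Space,
    WeakStab.secondCountableTopology_of_isLocalHomeomorph (X := connectedComponent σ) hC,
    WeakStab.exists_isManifold_isLocalDiffeomorph (H := WeakStab.Charges F) hC⟩
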